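/- Let $[a,b]$ be a compact interval with $a<b$, let $\varepsilon_0>0$, and for $\varepsilon\in[0,\varepsilon_0]$ let $q_\varepsilon\in L_2([a,b],\mathbb C)$ and $\alpha(\varepsilon),\beta(\varepsilon)\in\mathbb C^{2\times2}$. Put $D^{[1]}_\varepsilon y=y'-q_\varepsilon y$ and $D^{[2]}_\varepsilon y=-(D^{[1]}_\varepsilon y)'-q_\varepsilon D^{[1]}_\varepsilon y-q_\varepsilon^2y$ (with $y$ and $D^{[1]}_\varepsilon y$ absolutely continuous on $[a,b]$), and let $L_\varepsilon$ be the operator in $L_2([a,b],\mathbb C)$ given by $L_\varepsilon y=D^{[2]}_\varepsilon y$ (formally $-y''+q_\varepsilon'y$) on the domain of all $y\in L_2$ such that $D^{[2]}_\varepsilon y$ exists and lies in $L_2$ and $$\alpha(\varepsilon)\begin{pmatrix}y(a)\\ D^{[1]}_\varepsilon y(a)\end{pmatrix}+\beta(\varepsilon)\begin{pmatrix}y(b)\\ D^{[1]}_\varepsilon y(b)\end{pmatrix}=0 .$$ Write $c^\vee(t)=\int_a^tc(x)\,dx$ (entrywise for matrix functions), let $\|\cdot\|_C$ be the sup-norm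 on $[a,b]$, let $\|\cdot\|_1$ be the norm of $L_1([a,b],\mathbb C^{2\times2})$, and let $$A(\cdot;\varepsilon)=\begin{pmatrix}q_\varepsilon&1\\-q_\varepsilon^2&-q_\varepsilon\end{pmatrix},\qquad R(\cdot;\varepsilon)=A(\cdot;\varepsilon)-A(\cdot;0).$$ Suppose that the resolvent set of $L_0$ is not empty and that, as $\varepsilon\to+0$, 2) $\|(q_\varepsilon-q_0)^\vee\|_C\to0$; 3) $\|(q_\varepsilon^2-q_0^2)^\vee\|_C\to0$; 4) $\alpha(\varepsilon)\to\alpha(0)$ and $\beta(\varepsilon)\to\beta(0)$; and that at least one of the following three conditions holds as $\varepsilon\to+0$: (I) $\|R(\cdot;\varepsilon)R^\vee(\cdot;\varepsilon)\|_1\to0$; (II) $\|R^\vee(\cdot;\varepsilon)R(\cdot;\varepsilon)\|_1\to0$; (III) $\|R(\cdot;\varepsilon)R^\vee(\cdot;\varepsilon)-R^\vee(\cdot;\varepsilon)R(\cdot;\varepsilon)\|_1\to0$. Then $L_\varepsilon\to L_0$ in the norm resolvent sense: there is $\mu\in\mathbb C$ with $\mu\in\rho(L_0)$ and $\mu\in\rho(L_\varepsilon)$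 for all sufficiently small $\varepsilon>0$, and $\|(L_\varepsilon-\mu)^{-1}-(L_0-\mu)^{-1}\|\to0$ as $\varepsilon\to+0$. Moreover, each of (I), (II), (III) is, in view of 2) and 3), at least as general as the condition 1) $\|q_\varepsilon\|_2=O(1)$ as $\varepsilon\to+0$: if 1), 2) and 3) hold, then (I), (II) and (III) all hold. -/

import Mathlib

open MeasureTheory Set Filter Topology
open scoped ENNReal NNReal Matrix

noncomputable section

namespace SturmLiouville

/-! ### Unbounded operators: resolvent set, resolvent, norm resolvent convergence -/

section Resolvent

variable {E : Type*} [NormedAddCommGroup E] [NormedSpace ℂ E]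

/-- `S` is a bounded everywhere defined two-sided inverse of `T - z`. -/
def IsResolventAt (T : E →ₗ.[ℂ] E) (z : ℂ) (S : E →L[ℂ] E) : Prop :=
  (∀ f : E, ∃ h : S f ∈ T.domain, T ⟨S f, h⟩ - z • S f = f) ∧
    ∀ y : T.domain, S (T y - z • (y : E)) = y

/-- The resolvent set `ρ(T)`. -/
def resolventSet (T : E →ₗ.[ℂ] E) : Set ℂ := {z | ∃ S : E →L[ℂ] E, IsResolventAt T z S}

theorem IsResolventAt.unique {T : E →ₗ.[ℂ] E} {z : ℂ} {S S' : E →L[ℂ] E}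
    (h : IsResolventAt T z S) (h' : IsResolventAt T z S') : S = S' := by
  ext f
  obtain ⟨hd, hf⟩ := h.1 f
  have := h'.2 ⟨S f, hd⟩
  rw [hf] at this
  exact this.symm

open Classical in
/-- The resolvent `(T - z)⁻¹` for `z ∈ ρ(T)` (and `0` for other `z`). -/
def resolvent (T : E →ₗ.[ℂ] E) (z : ℂ) : E →L[ℂ] E :=
  if h : ∃ S : E →L[ℂ] E, IsResolventAt T z S then h.choose else 0

theorem resolvent_spec {T : E →ₗ.[ℂ] E} {z : ℂ} (hz : z ∈ resolventSet T) :
    IsResolventAt T z (resolvent T z) := by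
  have h : ∃ S : E →L[ℂ] E, IsResolventAt T z S := hz
  rw [resolvent, dif_pos h]
  exact h.choose_spec

/-- `L ε → L 0` in the sense of norm resolvent convergence as `ε → +0`. -/
def NormResolventConverges (L : ℝ → E →ₗ.[ℂ] E) : Prop :=
  ∃ z : ℂ, z ∈ resolventSet (L 0) ∧ (∀ᶠ ε in 𝓝[>] (0 : ℝ), z ∈ resolventSet (L ε)) ∧
    Tendsto (fun ε => ‖resolvent (L ε) z - resolvent (L 0) z‖) (𝓝[>] (0 : ℝ)) (𝓝 0)

end Resolvent

/-! ### The quasi-differential operator -/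

/-- On `[a, b]`, `y` has the quasi-derivatives `y₁ = D^[1] y = y' - q y` and
`y₂ = D^[2] y = -(D^[1] y)' - q D^[1] y - q² y`, where `y` and `y₁` are absolutely continuous
(`y₁` being the continuous representative) and derivatives are taken almost everywhere. -/
structure HasQuasiDerivs (a b : ℝ) (q y y₁ y₂ : ℝ → ℂ) : Prop where
  ac₀ : AbsolutelyContinuousOnInterval y a b
  ac₁ : AbsolutelyContinuousOnInterval y₁ a b
  eq₁ : ∀ᵐ t ∂(volume.restrict (Icc a b)),
    ∃ y' : ℂ, HasDerivAt y y' t ∧ y₁ t = y' - q t * y t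
  eq₂ : ∀ᵐ t ∂(volume.restrict (Icc a b)),
    ∃ y₁' : ℂ, HasDerivAt y₁ y₁' t ∧ y₂ t = -y₁' - q t * y₁ t - q t ^ 2 * y t

/-- The Hilbert space `L₂([a, b], ℂ)`. -/
abbrev L2 (a b : ℝ) : Type := Lp ℂ 2 (volume.restrict (Icc a b))

/-- The pair `(f, g)` belongs to the graph of the operator: `f` has a representative `y` with
`D^[2] y = g ∈ L₂` and `α (y(a), D^[1]y(a)) + β (y(b), D^[1]y(b)) = 0`. -/
def InGraph (a b : ℝ) (q : ℝ → ℂ) (α β : Matrix (Fin 2) (Fin 2) ℂ) (f g : L2 a b) : Prop :=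
  ∃ y y₁ y₂ : ℝ → ℂ, HasQuasiDerivs a b q y y₁ y₂ ∧
    f =ᵐ[volume.restrict (Icc a b)] y ∧ g =ᵐ[volume.restrict (Icc a b)] y₂ ∧
    α *ᵥ ![y a, y₁ a] + β *ᵥ ![y b, y₁ b] = 0

theorem InGraph.add {a b : ℝ} {q : ℝ → ℂ} {α β : Matrix (Fin 2) (Fin 2) ℂ}
    {f g f' g' : L2 a b} (h : InGraph a b q α β f g) (h' : InGraph a b q α β f' g') :
    InGraph a b q α β (f + f') (g + g') := by
  obtain ⟨y, y₁, y₂, H, hf, hg, hB⟩ := h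
  obtain ⟨z, z₁, z₂, H', hf', hg', hB'⟩ := h'
  refine ⟨y + z, y₁ + z₁, y₂ + z₂, ⟨H.ac₀.add H'.ac₀, H.ac₁.add H'.ac₁, ?_, ?_⟩, ?_, ?_, ?_⟩
  · filter_upwards [H.eq₁, H'.eq₁] with t ⟨d, hd, e⟩ ⟨d', hd', e'⟩
    exact ⟨d + d', hd.add hd', by simp only [Pi.add_apply, e, e']; ring⟩
  · filter_upwards [H.eq₂, H'.eq₂] with t ⟨d, hd, e⟩ ⟨d', hd', e'⟩
    exact ⟨d + d', hd.add hd', by simp only [Pi.add_apply, e, e']; ring⟩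
  · exact (Lp.coeFn_add f f').trans (hf.add hf')
  · exact (Lp.coeFn_add g g').trans (hg.add hg')
  · have e1 : ![(y + z) a, (y₁ + z₁) a] = ![y a, y₁ a] + ![z a, z₁ a] := by simp
    have e2 : ![(y + z) b, (y₁ + z₁) b] = ![y b, y₁ b] + ![z b, z₁ b] := by simp
    rw [e1, e2, Matrix.mulVec_add, Matrix.mulVec_add, add_add_add_comm, hB, hB', add_zero]

theorem InGraph.smul {a b : ℝ} {q : ℝ → ℂ} {α β : Matrix (Fin 2) (Fin 2) ℂ}
    {f g : L2 a b} (c : ℂ) (h : InGraph a b q α β f g) :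
    InGraph a b q α β (c • f) (c • g) := by
  obtain ⟨y, y₁, y₂, H, hf, hg, hB⟩ := h
  refine ⟨c • y, c • y₁, c • y₂, ⟨H.ac₀.const_smul c, H.ac₁.const_smul c, ?_, ?_⟩, ?_, ?_, ?_⟩
  · filter_upwards [H.eq₁] with t ⟨d, hd, e⟩
    exact ⟨c • d, hd.const_smul c, by simp only [Pi.smul_apply, smul_eq_mul, e]; ring⟩
  · filter_upwards [H.eq₂] with t ⟨d, hd, e⟩
    exact ⟨c • d, hd.const_smul c, by simp only [Pi.smul_apply, smul_eq_mul, e]; ring⟩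
  · exact (Lp.coeFn_smul c f).trans (hf.const_smul c)
  · exact (Lp.coeFn_smul c g).trans (hg.const_smul c)
  · have e1 : ![(c • y) a, (c • y₁) a] = c • ![y a, y₁ a] := by simp
    have e2 : ![(c • y) b, (c • y₁) b] = c • ![y b, y₁ b] := by simp
    rw [e1, e2, Matrix.mulVec_smul, Matrix.mulVec_smul, ← smul_add, hB, smul_zero]

theorem InGraph.zero (a b : ℝ) (q : ℝ → ℂ) (α β : Matrix (Fin 2) (Fin 2) ℂ) :
    InGraph a b q α β 0 0 := by
  have hc : AbsolutelyContinuousOnInterval (0 : ℝ → ℂ) a b :=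
    (contDiff_const (c := (0 : ℂ))).contDiffOn.absolutelyContinuousOnInterval
  refine ⟨0, 0, 0, ⟨hc, hc, ?_, ?_⟩, Lp.coeFn_zero _ _ _, Lp.coeFn_zero _ _ _, ?_⟩
  · exact .of_forall fun t => ⟨0, hasDerivAt_const t 0, by simp⟩
  · exact .of_forall fun t => ⟨0, hasDerivAt_const t 0, by simp⟩
  · have : ![(0 : ℂ), 0] = 0 := by ext i; fin_cases i <;> rfl
    simp [this]

/-- The graph of the operator generated by `l(y) = -y'' + q' y` and the boundary condition. -/
def graph (a b : ℝ) (q : ℝ → ℂ) (α β : Matrix (Fin 2) (Fin 2) ℂ) :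
    Submodule ℂ (L2 a b × L2 a b) where
  carrier := {p | InGraph a b q α β p.1 p.2}
  add_mem' h h' := InGraph.add h h'
  zero_mem' := InGraph.zero a b q α β
  smul_mem' c _ h := InGraph.smul c h

/-- If a function continuous on `[a, b]` vanishes almost everywhere there, it vanishes on the
interior. -/
theorem eqOn_Ioo_of_ae {a b : ℝ} {u : ℝ → ℂ} (hu : AbsolutelyContinuousOnInterval u a b)
    (h : u =ᵐ[volume.restrict (Icc a b)] 0) : EqOn u 0 (Ioo a b) := by
  rcases le_or_gt b a with hab | hab
  · simp [Ioo_eq_empty (not_lt.2 hab)]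
  have hc : ContinuousOn u (Icc a b) := by
    simpa [uIcc_of_le hab.le] using hu.continuousOn
  have := Measure.eqOn_Icc_of_ae_eq volume hab.ne h hc continuousOn_const
  exact this.mono Ioo_subset_Icc_self

/-- `D^[2] y` is determined by `y`, so `graph` is the graph of an operator. -/
theorem graph_singleValued (a b : ℝ) (q : ℝ → ℂ) (α β : Matrix (Fin 2) (Fin 2) ℂ)
    (p : L2 a b × L2 a b) (hp : p ∈ graph a b q α β) (h0 : p.1 = 0) : p.2 = 0 := by
  obtain ⟨y, y₁, y₂, H, hf, hg, -⟩ := hp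
  have hmem : ∀ᵐ t ∂(volume.restrict (Icc a b)), t ∈ Ioo a b := by
    rw [← restrict_Ioo_eq_restrict_Icc]
    exact ae_restrict_mem measurableSet_Ioo
  have hd : ∀ u : ℝ → ℂ, EqOn u 0 (Ioo a b) → ∀ t ∈ Ioo a b, ∀ d, HasDerivAt u d t → d = 0 := by
    intro u hu t ht d hd
    have : u =ᶠ[𝓝 t] fun _ => (0 : ℂ) :=
      eventually_of_mem (Ioo_mem_nhds ht.1 ht.2) fun s hs => hu hs
    exact hd.unique ((hasDerivAt_const t (0 : ℂ)).congr_of_eventuallyEq this)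
  have hy : EqOn y 0 (Ioo a b) := by
    refine eqOn_Ioo_of_ae H.ac₀ (hf.symm.trans ?_)
    rw [h0]
    exact Lp.coeFn_zero _ _ _
  have hy₁ : EqOn y₁ 0 (Ioo a b) := by
    refine eqOn_Ioo_of_ae H.ac₁ ?_
    filter_upwards [H.eq₁, hmem] with t ⟨d, hdt, e⟩ ht
    rw [e, hd y hy t ht d hdt, hy ht]
    simp
  refine Lp.ext (hg.trans (EventuallyEq.trans ?_ (Lp.coeFn_zero _ _ _).symm))
  filter_upwards [H.eq₂, hmem] with t ⟨d, hdt, e⟩ ht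
  rw [e, hd y₁ hy₁ t ht d hdt, hy ht, hy₁ ht]
  simp

/-- The operator `L y = l(y) = D^[2] y` in `L₂([a, b], ℂ)` with domain
`{y ∈ L₂ : ∃ D^[2] y ∈ L₂, α (y(a), D^[1]y(a)) + β (y(b), D^[1]y(b)) = 0}`. -/
def slOperator (a b : ℝ) (q : ℝ → ℂ) (α β : Matrix (Fin 2) (Fin 2) ℂ) :
    L2 a b →ₗ.[ℂ] L2 a b :=
  (graph a b q α β).toLinearPMap

theorem slOperator_mem_graph (a b : ℝ) (q : ℝ → ℂ) (α β : Matrix (Fin 2) (Fin 2) ℂ)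
    (f g : L2 a b) : (f, g) ∈ (slOperator a b q α β).graph ↔ InGraph a b q α β f g := by
  rw [slOperator, Submodule.toLinearPMap_graph_eq _ (graph_singleValued a b q α β)]
  rfl

/-! ### Norms and the system matrix -/

/-- The sup-norm on `[a, b]`. -/
def supNorm (a b : ℝ) (c : ℝ → ℂ) : ℝ≥0∞ := ⨆ t ∈ Icc a b, ‖c t‖ₑ

/-- The primitive `c^∨(t) = ∫_a^t c(x) dx`. -/
def primitive (a : ℝ) (c : ℝ → ℂ) : ℝ → ℂ := fun t => ∫ x in a..t, c x

/-- The entrywise primitive of a matrix function. -/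
def matPrimitive (a : ℝ) (M : ℝ → Matrix (Fin 2) (Fin 2) ℂ) : ℝ → Matrix (Fin 2) (Fin 2) ℂ :=
  fun t => Matrix.of fun i j => primitive a (fun x => M x i j) t

/-- The norm of `L₁([a, b], ℂ^{2×2})`. -/
def matL1Norm (a b : ℝ) (M : ℝ → Matrix (Fin 2) (Fin 2) ℂ) : ℝ≥0∞ :=
  ∑ i, ∑ j, eLpNorm (fun t => M t i j) 1 (volume.restrict (Icc a b))

/-- The matrix `A` of the first-order system equivalent to the quasi-differential equation. -/
def systemMatrix (q : ℝ → ℂ) : ℝ → Matrix (Fin 2) (Fin 2) ℂ :=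
  fun t => !![q t, 1; -(q t) ^ 2, -(q t)]

/-- `R(·; ε) = A(·; ε) - A(·; 0)`. -/
def matR (q : ℝ → ℝ → ℂ) (ε : ℝ) : ℝ → Matrix (Fin 2) (Fin 2) ℂ :=
  fun t => systemMatrix (q ε) t - systemMatrix (q 0) t

/-- `‖q_ε‖₂ = O(1)` as `ε → +0`. -/
def BoundedL2 (a b : ℝ) (q : ℝ → ℝ → ℂ) : Prop :=
  ∃ C : ℝ≥0, ∀ᶠ ε in 𝓝[>] (0 : ℝ), eLpNorm (q ε) 2 (volume.restrict (Icc a b)) ≤ C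

/-- `‖R R^∨‖₁ → 0` as `ε → +0`. -/
def CondI (a b : ℝ) (q : ℝ → ℝ → ℂ) : Prop :=
  Tendsto (fun ε => matL1Norm a b fun t => matR q ε t * matPrimitive a (matR q ε) t)
    (𝓝[>] (0 : ℝ)) (𝓝 0)

/-- `‖R^∨ R‖₁ → 0` as `ε → +0`. -/
def CondII (a b : ℝ) (q : ℝ → ℝ → ℂ) : Prop :=
  Tendsto (fun ε => matL1Norm a b fun t => matPrimitive a (matR q ε) t * matR q ε t)
    (𝓝[>] (0 : ℝ)) (𝓝 0)

/-- `‖R R^∨ - R^∨ R‖₁ → 0` as `ε → +0`. -/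
def CondIII (a b : ℝ) (q : ℝ → ℝ → ℂ) : Prop :=
  Tendsto (fun ε => matL1Norm a b fun t =>
      matR q ε t * matPrimitive a (matR q ε) t - matPrimitive a (matR q ε) t * matR q ε t)
    (𝓝[>] (0 : ℝ)) (𝓝 0)

end SturmLiouville

end

noncomputable section

namespace SturmLiouville


section FunctionSpaces

/-- The space `C([a, b], ℂ)`. -/
abbrev CI (a b : ℝ) : Type := C(Icc a b, ℂ)

/-- The space `L₁([a, b], ℂ)`. -/
abbrev L1 (a b : ℝ) : Type := Lp ℂ 1 (volume.restrict (Icc a b))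

theorem L1.integrableOn {a b : ℝ} (g : L1 a b) : IntegrableOn g (Icc a b) :=
  L1.integrable_coeFn g

theorem L1.intervalIntegrable {a b : ℝ} (g : L1 a b) {s t : ℝ} (hs : s ∈ Icc a b)
    (ht : t ∈ Icc a b) : IntervalIntegrable g volume s t :=
  ((integrableOn g).mono_set (uIcc_subset_Icc hs ht)).intervalIntegrable

theorem ae_mem_Ioo {a b : ℝ} : ∀ᵐ t ∂(volume.restrict (Icc a b)), t ∈ Ioo a b := by
  rw [← restrict_Ioo_eq_restrict_Icc]
  exact ae_restrict_mem measurableSet_Ioo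

variable {a b : ℝ} [hab : Fact (a < b)]

/-- Extension of a continuous function on `[a, b]` by its boundary values. -/
def ext : CI a b →L[ℂ] BoundedContinuousFunction ℝ ℂ :=
  LinearMap.mkContinuous
    { toFun := fun u => (BoundedContinuousFunction.mkOfCompact u).compContinuous
        ⟨projIcc a b hab.out.le, continuous_projIcc⟩
      map_add' := fun u v => by ext; rfl
      map_smul' := fun c u => by ext; rfl } 1
    (fun u => by
      rw [one_mul, BoundedContinuousFunction.norm_le (norm_nonneg u)]
      exact fun t => u.norm_coe_le_norm _)

theorem ext_apply (u : CI a b) (t : ℝ) : ext u t = u (projIcc a b hab.out.le t) := rfl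

theorem ext_of_mem (u : CI a b) {t : ℝ} (ht : t ∈ Icc a b) : ext u t = u ⟨t, ht⟩ := by
  rw [ext_apply, projIcc_of_mem _ ht]

@[simp] theorem ext_mul (u v : CI a b) (t : ℝ) : ext (u * v) t = ext u t * ext v t := rfl

/-- The class in `L_p` of a continuous function on `[a, b]`. -/
def toLpCI (p : ℝ≥0∞) [Fact (1 ≤ p)] : CI a b →L[ℂ] Lp ℂ p (volume.restrict (Icc a b)) :=
  (BoundedContinuousFunction.toLp p (volume.restrict (Icc a b)) ℂ).comp ext

theorem coeFn_toLpCI (p : ℝ≥0∞) [Fact (1 ≤ p)] (u : CI a b) :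
    toLpCI p u =ᵐ[volume.restrict (Icc a b)] ext u :=
  BoundedContinuousFunction.coeFn_toLp _ _ _ _

/-- The product `C([a, b]) × L₁ → L₁`. -/
def mulL1 : CI a b →L[ℂ] L1 a b →L[ℂ] L1 a b :=
  ((ContinuousLinearMap.mul ℂ ℂ).holderL (volume.restrict (Icc a b)) ∞ 1 1).comp (toLpCI ∞)

theorem coeFn_mulL1 (u : CI a b) (g : L1 a b) :
    mulL1 u g =ᵐ[volume.restrict (Icc a b)] fun t => ext u t * g t := by
  filter_upwards [(ContinuousLinearMap.mul ℂ ℂ).coeFn_holder (r := 1) (toLpCI ∞ u) g,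
    coeFn_toLpCI ∞ u] with t h1 h2
  rw [← h2]
  exact h1

/-- The product `C([a, b]) × L₂ → L₁`. -/
def mulL2 : CI a b →L[ℂ] L2 a b →L[ℂ] L1 a b :=
  ((ContinuousLinearMap.mul ℂ ℂ).holderL (volume.restrict (Icc a b)) 2 2 1).comp (toLpCI 2)

theorem coeFn_mulL2 (u : CI a b) (g : L2 a b) :
    mulL2 u g =ᵐ[volume.restrict (Icc a b)] fun t => ext u t * g t := by
  filter_upwards [(ContinuousLinearMap.mul ℂ ℂ).coeFn_holder (r := 1) (toLpCI 2 u) g,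
    coeFn_toLpCI 2 u] with t h1 h2
  rw [← h2]
  exact h1

theorem left_mem : a ∈ Icc a b := left_mem_Icc.2 hab.out.le
theorem right_mem : b ∈ Icc a b := right_mem_Icc.2 hab.out.le

/-- The primitive of an integrable function vanishing at the left endpoint. -/
def J : L1 a b →L[ℂ] CI a b :=
  LinearMap.mkContinuous
    { toFun := fun g => ⟨fun t => ∫ s in a..t, g s, by
        have h := intervalIntegral.continuousOn_primitive_interval
          (a := a) (b := b) (f := g) (μ := volume)
          (by rw [uIcc_of_le hab.out.le]; exact L1.integrableOn g)
        rw [uIcc_of_le hab.out.le] at h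
        exact continuousOn_iff_continuous_domRestrict.1 h⟩
      map_add' := fun f g => by
        ext t
        change ∫ s in a..(t : ℝ), (f + g : L1 a b) s = (∫ s in a..(t : ℝ), f s) + ∫ s in a..(t : ℝ), g s
        rw [← intervalIntegral.integral_add (L1.intervalIntegrable f left_mem t.2)
          (L1.intervalIntegrable g left_mem t.2)]
        refine intervalIntegral.integral_congr_ae ?_
        have := (ae_restrict_iff' measurableSet_Icc).1 (Lp.coeFn_add f g)
        filter_upwards [this] with s hs hs'
        rw [uIoc_of_le t.2.1] at hs'
        exact hs ⟨hs'.1.le, hs'.2.trans t.2.2⟩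
      map_smul' := fun c g => by
        ext t
        change ∫ s in a..(t : ℝ), (c • g : L1 a b) s = c • ∫ s in a..(t : ℝ), g s
        rw [← intervalIntegral.integral_smul]
        refine intervalIntegral.integral_congr_ae ?_
        have := (ae_restrict_iff' measurableSet_Icc).1 (Lp.coeFn_smul c g)
        filter_upwards [this] with s hs hs'
        rw [uIoc_of_le t.2.1] at hs'
        exact hs ⟨hs'.1.le, hs'.2.trans t.2.2⟩ } 1
    (fun g => by
      rw [one_mul, ContinuousMap.norm_le _ (norm_nonneg g)]
      intro t
      change ‖∫ s in a..(t : ℝ), g s‖ ≤ _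
      rw [L1.norm_eq_integral_norm, intervalIntegral.integral_of_le t.2.1]
      refine (norm_integral_le_integral_norm _).trans ?_
      exact setIntegral_mono_set (L1.integrableOn g).norm (ae_of_all _ fun _ => norm_nonneg _)
        (LE.le.eventuallyLE fun s hs => ⟨hs.1.le, hs.2.trans t.2.2⟩))

theorem J_apply (g : L1 a b) (t : Icc a b) : J g t = ∫ s in a..(t : ℝ), g s := rfl

theorem J_left (g : L1 a b) : J g ⟨a, left_mem⟩ = 0 := by
  rw [J_apply]; exact intervalIntegral.integral_same

end FunctionSpaces

section AbsoluteContinuity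

theorem AbsolutelyContinuousOnInterval.congr {f g : ℝ → ℂ} {a b : ℝ}
    (hf : AbsolutelyContinuousOnInterval f a b) (h : EqOn f g (uIcc a b)) :
    AbsolutelyContinuousOnInterval g a b := by
  refine Tendsto.congr' ?_ hf
  filter_upwards [mem_inf_of_right (mem_principal_self _)] with I hI
  refine Finset.sum_congr rfl fun i hi => ?_
  rw [h (hI.1 i hi).1, h (hI.1 i hi).2]

theorem _root_.LipschitzOnWith.comp_absolutelyContinuousOnInterval {φ : ℂ → ℂ} {f : ℝ → ℂ}
    {a b : ℝ} {K : ℝ≥0} {s : Set ℂ} (hφ : LipschitzOnWith K φ s) (hs : MapsTo f (uIcc a b) s)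
    (hf : AbsolutelyContinuousOnInterval f a b) :
    AbsolutelyContinuousOnInterval (fun t => φ (f t)) a b := by
  refine squeeze_zero' (Eventually.of_forall fun _ => Finset.sum_nonneg fun _ _ => dist_nonneg) ?_
    (by simpa using Tendsto.const_mul (K : ℝ) hf)
  filter_upwards [mem_inf_of_right (mem_principal_self _)] with I hI
  rw [Finset.mul_sum]
  exact Finset.sum_le_sum fun i hi => hφ.dist_le_mul _ (hs (hI.1 i hi).1) _ (hs (hI.1 i hi).2)

theorem AbsolutelyContinuousOnInterval.comp_entire {φ : ℂ → ℂ} {f : ℝ → ℂ} {a b : ℝ}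
    (hφ : Differentiable ℂ φ) (hf : AbsolutelyContinuousOnInterval f a b) :
    AbsolutelyContinuousOnInterval (fun t => φ (f t)) a b := by
  obtain ⟨C, hC⟩ := hf.exists_bound
  have hφ' : ContDiff ℂ 1 φ := hφ.contDiff
  obtain ⟨K, hK⟩ := ((hφ'.restrict_scalars ℝ).contDiffOn (s := Metric.closedBall 0 C)).exists_lipschitzOnWith
    one_ne_zero (convex_closedBall _ _) (isCompact_closedBall _ _)
  exact hK.comp_absolutelyContinuousOnInterval
    (fun t ht => mem_closedBall_zero_iff.2 (hC t ht)) hf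

theorem _root_.IntervalIntegrable.absolutelyContinuousOnInterval_primitive {f : ℝ → ℂ} {a b : ℝ}
    (h : IntervalIntegrable f volume a b) :
    AbsolutelyContinuousOnInterval (fun x => ∫ v in a..x, f v) a b := by
  have hn := h.norm.absolutelyContinuousOnInterval_intervalIntegral (c := a) left_mem_uIcc
  refine squeeze_zero' (Eventually.of_forall fun _ => Finset.sum_nonneg fun _ _ => dist_nonneg) ?_
    hn
  filter_upwards [mem_inf_of_right (mem_principal_self _)] with I hI
  refine Finset.sum_le_sum fun i hi => ?_
  have key : ∀ s ∈ uIcc a b, IntervalIntegrable f volume a s := fun s hs =>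
    h.mono_set (uIcc_subset_uIcc_left hs)
  have h1 := key _ (hI.1 i hi).1
  have h2 := key _ (hI.1 i hi).2
  rw [dist_eq_norm, Real.dist_eq, intervalIntegral.integral_interval_sub_left h1 h2,
    intervalIntegral.integral_interval_sub_left h1.norm h2.norm]
  exact intervalIntegral.norm_integral_le_abs_integral_norm

variable {a b : ℝ} [hab : Fact (a < b)]

/-- A continuous function is a primitive of `g ∈ L₁` if and only if it is absolutely continuous
with derivative `g` almost everywhere. -/
theorem eq_const_add_J_iff (u : CI a b) (g : L1 a b) :
    u = ContinuousMap.const _ (u ⟨a, left_mem⟩) + J g ↔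
      AbsolutelyContinuousOnInterval (ext u) a b ∧
        ∀ᵐ t ∂(volume.restrict (Icc a b)), HasDerivAt (ext u) (g t) t := by
  have hI : IntervalIntegrable g volume a b := L1.intervalIntegrable g left_mem right_mem
  have hac := hI.absolutelyContinuousOnInterval_primitive
  have hd : ∀ᵐ t ∂(volume.restrict (Icc a b)), HasDerivAt (fun x => ∫ v in a..x, g v) (g t) t := by
    rw [ae_restrict_iff' measurableSet_Icc]
    filter_upwards [hI.ae_hasDerivAt_integral] with t ht h
    exact ht (Icc_subset_uIcc h) a left_mem_uIcc
  have hext : EqOn (ext (J g)) (fun x => ∫ v in a..x, g v) (Icc a b) := fun t ht => by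
    rw [ext_of_mem _ ht]; rfl
  have hac' : AbsolutelyContinuousOnInterval (ext (J g)) a b :=
    AbsolutelyContinuousOnInterval.congr hac (by rw [uIcc_of_le hab.out.le]; exact hext.symm)
  have hd' : ∀ᵐ t ∂(volume.restrict (Icc a b)), HasDerivAt (ext (J g)) (g t) t := by
    filter_upwards [hd, ae_mem_Ioo] with t ht hm
    exact ht.congr_of_eventuallyEq (hext.eventuallyEq_of_mem (Icc_mem_nhds hm.1 hm.2))
  constructor
  · intro h
    have he : (ext u : ℝ → ℂ) = fun t => u ⟨a, left_mem⟩ + ext (J g) t := by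
      funext t; rw [ext_apply]; conv_lhs => rw [h]
      rfl
    rw [he]
    refine ⟨?_, hd'.mono fun t ht => ht.const_add _⟩
    exact (contDiff_const (c := u ⟨a, left_mem⟩)).contDiffOn.absolutelyContinuousOnInterval.add
      hac'
  · rintro ⟨h1, h2⟩
    obtain ⟨C, hC⟩ := (h1.sub hac').const_of_ae_hasDerivAt_zero (by
      have := h2.and hd'
      rw [ae_restrict_iff' measurableSet_Icc] at this
      filter_upwards [this] with t ht h
      rw [uIcc_of_le hab.out.le] at h
      simpa using (ht h).1.sub (ht h).2)
    rw [uIcc_of_le hab.out.le] at hC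
    have hCa : u ⟨a, left_mem⟩ = C := by
      have := hC a left_mem
      rwa [Pi.sub_apply, ext_of_mem _ left_mem, ext_of_mem _ left_mem, J_left, sub_zero] at this
    ext t
    have := hC t t.2
    rw [Pi.sub_apply, ext_of_mem _ t.2, ext_of_mem _ t.2] at this
    rw [ContinuousMap.add_apply, ContinuousMap.const_apply, hCa, ← this]
    simp

end AbsoluteContinuity


section Sinhc

/-- The entire function `sinh z / z`. -/
def sinhc : ℂ → ℂ := dslope Complex.sinh 0

theorem differentiable_sinhc : Differentiable ℂ sinhc := by
  rw [← differentiableOn_univ]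
  exact (Complex.differentiableOn_dslope univ_mem).2 Complex.differentiable_sinh.differentiableOn

theorem mul_sinhc (z : ℂ) : z * sinhc z = Complex.sinh z := by
  have := sub_smul_dslope Complex.sinh 0 z
  rwa [sub_zero, Complex.sinh_zero, sub_zero] at this

theorem sinhc_add_mul_deriv (z : ℂ) : sinhc z + z * deriv sinhc z = Complex.cosh z := by
  have h1 : HasDerivAt (fun z => z * sinhc z) (1 * sinhc z + z * deriv sinhc z) z :=
    (hasDerivAt_id z).mul (differentiable_sinhc z).hasDerivAt
  rw [one_mul, funext mul_sinhc] at h1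
  exact h1.unique (Complex.hasDerivAt_sinh z)

theorem exp_sub_sinhc (z : ℂ) : Complex.exp z - sinhc z = z * (deriv sinhc z + sinhc z) := by
  rw [← Complex.cosh_add_sinh, ← sinhc_add_mul_deriv, ← mul_sinhc]
  ring

theorem continuous_deriv_sinhc : Continuous (deriv sinhc) :=
  (differentiable_sinhc.contDiff (n := 1)).continuous_deriv le_rfl

end Sinhc

section Composition

variable {a b : ℝ}

/-- `exp ∘ p`. -/
def expCI (p : CI a b) : CI a b := (⟨Complex.exp, Complex.continuous_exp⟩ : C(ℂ, ℂ)).comp p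

/-- The lower left entry `-r sinh(p) / p` of the exponential of `!![p, 0; -r, -p]`. -/
def offDiag (p r : CI a b) : CI a b :=
  -(r * (⟨sinhc, differentiable_sinhc.continuous⟩ : C(ℂ, ℂ)).comp p)

/-- The factor of `r' p - r p'` in the transformed system. -/
def commFactor (p : CI a b) : CI a b :=
  (⟨fun z => deriv sinhc z + sinhc z,
    continuous_deriv_sinhc.add differentiable_sinhc.continuous⟩ : C(ℂ, ℂ)).comp p

theorem continuous_expCI : Continuous (expCI (a := a) (b := b)) :=
  ContinuousMap.continuous_postcomp _

theorem continuous_offDiag : Continuous fun z : CI a b × CI a b => offDiag z.1 z.2 :=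
  (continuous_snd.mul ((ContinuousMap.continuous_postcomp _).comp continuous_fst)).neg

theorem continuous_commFactor : Continuous (commFactor (a := a) (b := b)) :=
  ContinuousMap.continuous_postcomp _

end Composition

section Instances

variable {a b : ℝ}

instance : ContinuousAdd (CI a b × CI a b →L[ℂ] ℂ) :=
  (inferInstance : IsTopologicalAddGroup (CI a b × CI a b →L[ℂ] ℂ)).toContinuousAdd
instance : ContinuousAdd (CI a b × CI a b →L[ℂ] CI a b) :=
  (inferInstance : IsTopologicalAddGroup (CI a b × CI a b →L[ℂ] CI a b)).toContinuousAdd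
instance : ContinuousAdd (CI a b × CI a b →L[ℂ] CI a b × CI a b) :=
  (inferInstance : IsTopologicalAddGroup (CI a b × CI a b →L[ℂ] CI a b × CI a b)).toContinuousAdd
instance : ContinuousSub (CI a b × CI a b →L[ℂ] ℂ) :=
  haveI : IsTopologicalAddGroup (CI a b × CI a b →L[ℂ] ℂ) := inferInstance
  ⟨this.continuous_add.comp (continuous_fst.prodMk (this.continuous_neg.comp continuous_snd)) |>.congr
    fun _ => (sub_eq_add_neg _ _).symm⟩
instance : ContinuousSub (CI a b × CI a b →L[ℂ] CI a b × CI a b) :=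
  haveI : IsTopologicalAddGroup (CI a b × CI a b →L[ℂ] CI a b × CI a b) := inferInstance
  ⟨this.continuous_add.comp (continuous_fst.prodMk (this.continuous_neg.comp continuous_snd)) |>.congr
    fun _ => (sub_eq_add_neg _ _).symm⟩

end Instances

section Constants

variable {a b : ℝ}

/-- Constant functions. -/
def cst : ℂ →L[ℂ] CI a b := ContinuousLinearMap.toSpanSingleton ℂ (1 : CI a b)

theorem isCompactOperator_cst_comp (l : CI a b × CI a b →L[ℂ] ℂ) :
    IsCompactOperator ((cst : ℂ →L[ℂ] CI a b).comp l) :=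
  (isCompactOperator_of_locallyCompactSpace_dom l).clm_comp (cst : ℂ →L[ℂ] CI a b)

end Constants

section System

variable {a b : ℝ} [hab : Fact (a < b)]

/-- The Volterra operator `u ↦ ∫_a^t c u`. -/
def volterra (c : L1 a b) : CI a b →L[ℂ] CI a b := J.comp (mulL1.flip c)

theorem volterra_apply (c : L1 a b) (u : CI a b) : volterra c u = J (mulL1 u c) := rfl

theorem continuous_volterra : Continuous (volterra (a := a) (b := b)) := by
  unfold volterra
  fun_prop

theorem norm_volterra_sub_le (c : L1 a b) (u : CI a b) (hu : ‖u‖ ≤ 1) (s t : Icc a b) :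
    dist (volterra c u s) (volterra c u t) ≤
      dist (∫ x in a..(s : ℝ), ‖c x‖) (∫ x in a..(t : ℝ), ‖c x‖) := by
  rw [volterra_apply, J_apply, J_apply, dist_eq_norm, Real.dist_eq,
    intervalIntegral.integral_interval_sub_left (L1.intervalIntegrable _ left_mem s.2)
      (L1.intervalIntegrable _ left_mem t.2),
    intervalIntegral.integral_interval_sub_left (L1.intervalIntegrable _ left_mem s.2).norm
      (L1.intervalIntegrable _ left_mem t.2).norm]
  refine intervalIntegral.norm_integral_le_abs_of_norm_le ?_
    (L1.intervalIntegrable _ t.2 s.2).norm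
  have h := (ae_restrict_iff' measurableSet_Icc).1 (coeFn_mulL1 u c)
  rw [ae_restrict_iff' measurableSet_uIoc]
  filter_upwards [h] with x hx hm
  rw [hx (uIcc_subset_Icc t.2 s.2 (uIoc_subset_uIcc hm)), norm_mul]
  exact mul_le_of_le_one_left (norm_nonneg _) ((u.norm_coe_le_norm _).trans hu)

theorem isCompactOperator_volterra (c : L1 a b) : IsCompactOperator (volterra c) := by
  let e : CI a b ≃L[ℂ] BoundedContinuousFunction (Icc a b) ℂ :=
    (ContinuousMap.linearIsometryBoundedOfCompact (Icc a b) ℂ ℂ).toContinuousLinearEquiv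
  have hG : Continuous fun t : Icc a b => ∫ x in a..(t : ℝ), ‖c x‖ := by
    have h := intervalIntegral.continuousOn_primitive_interval
      (a := a) (b := b) (f := fun x => ‖c x‖) (μ := volume)
      (by rw [uIcc_of_le hab.out.le]; exact (L1.integrableOn c).norm)
    rw [uIcc_of_le hab.out.le] at h
    exact continuousOn_iff_continuous_domRestrict.1 h
  have hcomp : IsCompactOperator ((e : CI a b →L[ℂ] BoundedContinuousFunction (Icc a b) ℂ) ∘L volterra c) := by
    refine (isCompactOperator_iff_isCompact_closure_image_closedBall
      ((e : CI a b →L[ℂ] BoundedContinuousFunction (Icc a b) ℂ) ∘L volterra c).toLinearMap one_pos).2 ?_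
    refine BoundedContinuousFunction.arzela_ascoli (Metric.closedBall 0 ‖volterra c‖)
      (isCompact_closedBall _ _) _ ?_ ?_
    · rintro _ t ⟨u, hu, rfl⟩
      rw [mem_closedBall_zero_iff] at hu ⊢
      exact ((volterra c u).norm_coe_le_norm t).trans ((volterra c).unit_le_opNorm u hu)
    · intro t
      rw [Metric.equicontinuousAt_iff]
      intro ε hε
      obtain ⟨δ, hδ, h⟩ := Metric.continuousAt_iff.1 hG.continuousAt ε hε
      refine ⟨δ, hδ, fun s hs => ?_⟩
      rintro ⟨_, u, hu, rfl⟩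
      rw [mem_closedBall_zero_iff] at hu
      rw [dist_comm]
      exact (norm_volterra_sub_le c u hu s t).trans_lt (h hs)
  have := hcomp.clm_comp (e.symm : _ →L[ℂ] CI a b)
  have he : ⇑(e.symm : BoundedContinuousFunction (Icc a b) ℂ →L[ℂ] CI a b) ∘
      ⇑((e : CI a b →L[ℂ] BoundedContinuousFunction (Icc a b) ℂ) ∘L volterra c) = volterra c :=
    funext fun u => e.symm_apply_apply (volterra c u)
  rwa [he] at this

/-- The parameters `(p, r, r' p - r p', α, β)` of the transformed system. -/
abbrev Param (a b : ℝ) : Type :=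
  CI a b × CI a b × L1 a b × Matrix (Fin 2) (Fin 2) ℂ × Matrix (Fin 2) (Fin 2) ℂ

/-- The upper left coefficient of the transformed system. -/
def coeff₁₁ (q₀ : L1 a b) (π : Param a b) : L1 a b :=
  q₀ + toLpCI 1 (expCI (-π.1) * offDiag π.1 π.2.1)

/-- The upper right coefficient of the transformed system. -/
def coeff₁₂ (π : Param a b) : L1 a b :=
  toLpCI 1 (expCI (-π.1) * expCI (-π.1))

/-- The lower left coefficient of the transformed system; `s₀` is the class of `q₀ ^ 2 + μ`. -/
def coeff₂₁ (q₀ s₀ : L1 a b) (π : Param a b) : L1 a b :=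
  -(mulL1 (expCI π.1 * commFactor π.1) π.2.2.1
    + (2 : ℂ) • mulL1 (expCI π.1 * offDiag π.1 π.2.1) q₀
    + mulL1 (expCI π.1 * expCI π.1) s₀
    + toLpCI 1 (offDiag π.1 π.2.1 * offDiag π.1 π.2.1))

/-- The lower right coefficient of the transformed system. -/
def coeff₂₂ (q₀ : L1 a b) (π : Param a b) : L1 a b :=
  -(q₀ + toLpCI 1 (offDiag π.1 π.2.1 * expCI (-π.1)))

/-- Evaluation at a point. -/
def ev (t : Icc a b) : CI a b →L[ℂ] ℂ := ContinuousMap.evalCLM ℂ t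

/-- The `i`-th boundary form in the transformed variables. -/
def boundaryForm (i : Fin 2) (π : Param a b) : CI a b × CI a b →L[ℂ] ℂ :=
  π.2.2.2.1 i 0 • (ev ⟨a, left_mem⟩).comp (.fst ℂ _ _)
  + π.2.2.2.1 i 1 • (ev ⟨a, left_mem⟩).comp (.snd ℂ _ _)
  + (π.2.2.2.2 i 0 * expCI π.1 ⟨b, right_mem⟩ + π.2.2.2.2 i 1 * offDiag π.1 π.2.1 ⟨b, right_mem⟩) •
      (ev ⟨b, right_mem⟩).comp (.fst ℂ _ _)
  + (π.2.2.2.2 i 1 * expCI (-π.1) ⟨b, right_mem⟩) • (ev ⟨b, right_mem⟩).comp (.snd ℂ _ _)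

/-- The compact part of the integral equation equivalent to the boundary value problem. -/
def compactPart (q₀ s₀ : L1 a b) (π : Param a b) :
    CI a b × CI a b →L[ℂ] CI a b × CI a b :=
  (ContinuousLinearMap.inl ℂ _ _).comp
    (cst.comp ((ev ⟨a, left_mem⟩).comp (.fst ℂ _ _) - boundaryForm 0 π)
      + (volterra (coeff₁₁ q₀ π)).comp (.fst ℂ _ _) + (volterra (coeff₁₂ π)).comp (.snd ℂ _ _))
  + (ContinuousLinearMap.inr ℂ _ _).comp
    (cst.comp ((ev ⟨a, left_mem⟩).comp (.snd ℂ _ _) - boundaryForm 1 π)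
      + (volterra (coeff₂₁ q₀ s₀ π)).comp (.fst ℂ _ _)
      + (volterra (coeff₂₂ q₀ π)).comp (.snd ℂ _ _))

/-- The operator of the integral equation equivalent to the boundary value problem. -/
def bvpOperator (q₀ s₀ : L1 a b) (π : Param a b) :
    CI a b × CI a b →L[ℂ] CI a b × CI a b := 1 - compactPart q₀ s₀ π

theorem continuous_bvpOperator (q₀ s₀ : L1 a b) : Continuous (bvpOperator q₀ s₀) := by
  have h1 := continuous_expCI (a := a) (b := b)
  have h2 : Continuous fun π : Param a b => offDiag π.1 π.2.1 :=
    continuous_offDiag.comp (continuous_fst.prodMk (continuous_fst.comp continuous_snd))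
  have h3 := continuous_commFactor (a := a) (b := b)
  have h4 := continuous_volterra (a := a) (b := b)
  have h5 : Continuous fun π : Param a b => expCI (-π.1) := h1.comp continuous_fst.neg
  have h6 : Continuous fun π : Param a b => expCI π.1 := h1.comp continuous_fst
  have h7 : Continuous fun π : Param a b => commFactor π.1 := h3.comp continuous_fst
  have c11 : Continuous fun π => volterra (coeff₁₁ q₀ π) :=
    h4.comp (continuous_const.add ((toLpCI 1).continuous.comp (h5.mul h2)))
  have c12 : Continuous fun π : Param a b => volterra (coeff₁₂ π) :=
    h4.comp ((toLpCI 1).continuous.comp (h5.mul h5))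
  have c22 : Continuous fun π => volterra (coeff₂₂ q₀ π) :=
    h4.comp (continuous_const.add ((toLpCI 1).continuous.comp (h2.mul h5))).neg
  have c21 : Continuous fun π => volterra (coeff₂₁ q₀ s₀ π) := by
    refine h4.comp ((((Continuous.clm_apply ?_ (by fun_prop)).add ?_).add ?_).add ?_).neg
    · exact mulL1.continuous.comp (h6.mul h7)
    · exact ((mulL1.continuous.comp (h6.mul h2)).clm_apply continuous_const).const_smul (2 : ℂ)
    · exact (mulL1.continuous.comp (h6.mul h6)).clm_apply continuous_const
    · exact (toLpCI 1).continuous.comp (h2.mul h2)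
  have e1 (t : Icc a b) : Continuous fun π : Param a b => expCI π.1 t :=
    (continuous_eval_const t).comp h6
  have e2 (t : Icc a b) : Continuous fun π : Param a b => expCI (-π.1) t :=
    (continuous_eval_const t).comp h5
  have e3 (t : Icc a b) : Continuous fun π : Param a b => offDiag π.1 π.2.1 t :=
    (continuous_eval_const t).comp h2
  have hα (i j : Fin 2) : Continuous fun π : Param a b => π.2.2.2.1 i j := by fun_prop
  have hβ (i j : Fin 2) : Continuous fun π : Param a b => π.2.2.2.2 i j := by fun_prop
  have hB (i : Fin 2) : Continuous (boundaryForm (a := a) (b := b) i) :=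
    ((((hα i 0).smul continuous_const).add ((hα i 1).smul continuous_const)).add
      ((((hβ i 0).mul (e1 _)).add ((hβ i 1).mul (e3 _))).smul continuous_const)).add
      (((hβ i 1).mul (e2 _)).smul continuous_const)
  refine Continuous.sub (f := fun _ => (1 : CI a b × CI a b →L[ℂ] CI a b × CI a b))
    (g := compactPart q₀ s₀) continuous_const (Continuous.add ?_ ?_)
  · exact continuous_const.clm_comp (((continuous_const.clm_comp (continuous_const.sub (hB 0))).add
      (c11.clm_comp continuous_const)).add (c12.clm_comp continuous_const))
  · exact continuous_const.clm_comp (((continuous_const.clm_comp (continuous_const.sub (hB 1))).add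
      (c21.clm_comp continuous_const)).add (c22.clm_comp continuous_const))

theorem isCompactOperator_compactPart (q₀ s₀ : L1 a b) (π : Param a b) :
    IsCompactOperator (compactPart q₀ s₀ π) := by
  refine IsCompactOperator.add (f := ⇑((ContinuousLinearMap.inl ℂ _ _).comp _))
    (g := ⇑((ContinuousLinearMap.inr ℂ _ _).comp _)) ?_ ?_
  · exact (((isCompactOperator_cst_comp _).add ((isCompactOperator_volterra _).comp_clm _)).add
      ((isCompactOperator_volterra _).comp_clm _)).clm_comp (ContinuousLinearMap.inl ℂ _ _)
  · exact (((isCompactOperator_cst_comp _).add ((isCompactOperator_volterra _).comp_clm _)).add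
      ((isCompactOperator_volterra _).comp_clm _)).clm_comp (ContinuousLinearMap.inr ℂ _ _)

theorem isUnit_bvpOperator_of_ker (q₀ s₀ : L1 a b) (π : Param a b)
    (h : ∀ z, bvpOperator q₀ s₀ π z = 0 → z = 0) : IsUnit (bvpOperator q₀ s₀ π) := by
  rcases (isCompactOperator_compactPart q₀ s₀ π).hasEigenvalue_or_mem_resolventSet
    (one_ne_zero (α := ℂ)) with he | hr
  · obtain ⟨z, hz⟩ := he.exists_hasEigenvector
    refine (hz.2 (h z ?_)).elim
    have := hz.apply_eq_smul
    rw [one_smul] at this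
    change z - compactPart q₀ s₀ π z = 0
    exact sub_eq_zero.2 this.symm
  · simpa [bvpOperator, spectrum.mem_resolventSet_iff] using hr

/-- The solution operator `f ↦ y` of the boundary value problem. -/
def solutionOperator (q₀ s₀ : L1 a b) (π : Param a b) : L2 a b →L[ℂ] L2 a b :=
  (toLpCI 2).comp ((ContinuousLinearMap.mul ℂ (CI a b) (expCI π.1)).comp
    ((ContinuousLinearMap.fst ℂ _ _).comp ((Ring.inverse (bvpOperator q₀ s₀ π)).comp
      ((ContinuousLinearMap.inr ℂ _ _).comp (-(J.comp (mulL2 (expCI π.1))))))))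

theorem continuousAt_solutionOperator (q₀ s₀ : L1 a b) (π : Param a b)
    (h : IsUnit (bvpOperator q₀ s₀ π)) : ContinuousAt (solutionOperator q₀ s₀) π := by
  have h6 : Continuous fun π : Param a b => expCI π.1 := continuous_expCI.comp continuous_fst
  have hinv : ContinuousAt (fun π => Ring.inverse (bvpOperator q₀ s₀ π)) π := by
    obtain ⟨x, hx⟩ := h
    refine ContinuousAt.comp (g := Ring.inverse) ?_ (continuous_bvpOperator q₀ s₀).continuousAt
    rw [← hx]
    exact NormedRing.inverse_continuousAt (R := CI a b × CI a b →L[ℂ] CI a b × CI a b) x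
  refine continuousAt_const.clm_comp (ContinuousAt.clm_comp ?_ (continuousAt_const.clm_comp
    (hinv.clm_comp (continuousAt_const.clm_comp
      (continuousAt_const.clm_comp ?_).neg))))
  · exact ((ContinuousLinearMap.mul ℂ (CI a b)).continuous.comp h6).continuousAt
  · exact (mulL2.continuous.comp h6).continuousAt

end System


section Transformation

open Complex in
/-- The substitution `y = e^p v`, `D^[1] y = x v + e^{-p} w` maps solutions of the transformed
system to solutions of the quasi-differential equation. -/
theorem hasDerivAt_of_transformed {p r v w : ℝ → ℂ} {t : ℝ} {q q₀ s₀ f μ v' w' : ℂ}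
    (hp : HasDerivAt p (q - q₀) t) (hr : HasDerivAt r (q ^ 2 - q₀ ^ 2) t)
    (hv : HasDerivAt v v' t) (hw : HasDerivAt w w' t) (hs : s₀ = q₀ ^ 2 + μ)
    (hv' : v' = (q₀ + exp (-p t) * -(r t * sinhc (p t))) * v t
      + exp (-p t) * exp (-p t) * w t)
    (hw' : w' = -(exp (p t) * (deriv sinhc (p t) + sinhc (p t)) *
          (p t * (q ^ 2 - q₀ ^ 2) - r t * (q - q₀))
        + 2 * (exp (p t) * -(r t * sinhc (p t)) * q₀) + exp (p t) * exp (p t) * s₀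
        + -(r t * sinhc (p t)) * -(r t * sinhc (p t))) * v t
      + -(q₀ + -(r t * sinhc (p t)) * exp (-p t)) * w t - exp (p t) * f) :
    HasDerivAt (fun t => exp (p t) * v t)
        (q * (exp (p t) * v t) + (-(r t * sinhc (p t)) * v t + exp (-p t) * w t)) t ∧
      HasDerivAt (fun t => -(r t * sinhc (p t)) * v t + exp (-p t) * w t)
        (-(f + μ * (exp (p t) * v t)) - q * (-(r t * sinhc (p t)) * v t + exp (-p t) * w t)
          - q ^ 2 * (exp (p t) * v t)) t := by
  have hE := hp.cexp
  have hF := hp.neg.cexp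
  have hh : HasDerivAt (fun t => sinhc (p t)) (deriv sinhc (p t) * (q - q₀)) t :=
    (differentiable_sinhc (p t)).hasDerivAt.comp t hp
  have hx := (hr.mul hh).neg
  have hEF : exp (p t) * exp (-p t) = 1 := by rw [← exp_add]; simp
  have hH := exp_sub_sinhc (p t)
  simp only [Pi.neg_apply] at hF
  constructor
  · refine (hE.mul hv).congr_deriv ?_
    rw [hv']
    linear_combination (-(r t * sinhc (p t)) * v t + exp (-p t) * w t) * hEF
  · refine ((hx.mul hv).add (hF.mul hw)).congr_deriv ?_
    simp only [Pi.neg_apply, Pi.mul_apply]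
    rw [hv', hw', hs]
    linear_combination (-((deriv sinhc (p t) + sinhc (p t)) *
      (p t * (q ^ 2 - q₀ ^ 2) - r t * (q - q₀)) + 2 * -(r t * sinhc (p t)) * q₀
      + exp (p t) * (q₀ ^ 2 + μ)) * v t - f) * hEF + v t * (q ^ 2 - q₀ ^ 2) * hH

open Complex in
/-- The substitution `v = e^{-p} y`, `w = e^p D^[1] y - x y` maps solutions of the
quasi-differential equation to solutions of the transformed system. -/
theorem hasDerivAt_transformed {p r y y₁ : ℝ → ℂ} {t : ℝ} {q q₀ s₀ f μ y' y₁' : ℂ}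
    (hp : HasDerivAt p (q - q₀) t) (hr : HasDerivAt r (q ^ 2 - q₀ ^ 2) t)
    (hy : HasDerivAt y y' t) (hy₁ : HasDerivAt y₁ y₁' t) (hs : s₀ = q₀ ^ 2 + μ)
    (hy' : y' = q * y t + y₁ t)
    (hy₁' : y₁' = -(f + μ * y t) - q * y₁ t - q ^ 2 * y t) :
    HasDerivAt (fun t => exp (-p t) * y t)
        ((q₀ + exp (-p t) * -(r t * sinhc (p t))) * (exp (-p t) * y t)
      + exp (-p t) * exp (-p t) * (exp (p t) * y₁ t - -(r t * sinhc (p t)) * y t)) t ∧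
      HasDerivAt (fun t => exp (p t) * y₁ t - -(r t * sinhc (p t)) * y t)
        (-(exp (p t) * (deriv sinhc (p t) + sinhc (p t)) *
          (p t * (q ^ 2 - q₀ ^ 2) - r t * (q - q₀))
        + 2 * (exp (p t) * -(r t * sinhc (p t)) * q₀) + exp (p t) * exp (p t) * s₀
        + -(r t * sinhc (p t)) * -(r t * sinhc (p t))) * (exp (-p t) * y t)
      + -(q₀ + -(r t * sinhc (p t)) * exp (-p t)) * (exp (p t) * y₁ t - -(r t * sinhc (p t)) * y t)
      - exp (p t) * f) t := by
  have hE := hp.cexp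
  have hF := hp.neg.cexp
  have hh : HasDerivAt (fun t => sinhc (p t)) (deriv sinhc (p t) * (q - q₀)) t :=
    (differentiable_sinhc (p t)).hasDerivAt.comp t hp
  have hx := (hr.mul hh).neg
  have hEF : exp (p t) * exp (-p t) = 1 := by rw [← exp_add]; simp
  have hH := exp_sub_sinhc (p t)
  simp only [Pi.neg_apply] at hF
  constructor
  · refine (hF.mul hy).congr_deriv ?_
    rw [hy']
    linear_combination (-exp (-p t) * y₁ t) * hEF
  · refine ((hE.mul hy₁).sub (hx.mul hy)).congr_deriv ?_
    simp only [Pi.neg_apply, Pi.mul_apply]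
    rw [hy', hy₁', hs]
    linear_combination (((deriv sinhc (p t) + sinhc (p t)) *
      (p t * (q ^ 2 - q₀ ^ 2) - r t * (q - q₀)) + 2 * -(r t * sinhc (p t)) * q₀
      + exp (p t) * (q₀ ^ 2 + μ)) * y t + -(r t * sinhc (p t)) * y₁ t) * hEF
      - y t * (q ^ 2 - q₀ ^ 2) * hH

end Transformation

section Classes

variable {a b : ℝ}

open Classical in
/-- The class in `L₁` of an integrable function (and `0` for other functions). -/
def classL1 (g : ℝ → ℂ) : L1 a b :=
  if h : Integrable g (volume.restrict (Icc a b)) then h.toL1 g else 0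

theorem coeFn_classL1 {g : ℝ → ℂ} (h : Integrable g (volume.restrict (Icc a b))) :
    (classL1 g : L1 a b) =ᵐ[volume.restrict (Icc a b)] g := by
  rw [classL1, dif_pos h]
  exact h.coeFn_toL1

theorem classL1_zero : classL1 (fun _ => 0) = (0 : L1 a b) := by
  have h : Integrable (fun _ => (0 : ℂ)) (volume.restrict (Icc a b)) := integrable_zero _ _ _
  rw [classL1, dif_pos h]
  exact Integrable.toL1_zero _

theorem integrable_of_memLp_two {q : ℝ → ℂ} (hq : MemLp q 2 (volume.restrict (Icc a b))) :
    Integrable q (volume.restrict (Icc a b)) :=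
  hq.integrable one_le_two

theorem integrable_sq_of_memLp_two {q : ℝ → ℂ} (hq : MemLp q 2 (volume.restrict (Icc a b))) :
    Integrable (fun t => q t ^ 2) (volume.restrict (Icc a b)) := by
  have := hq.integrable_mul hq
  rwa [← sq] at this

theorem integrable_sub_of_memLp_two {q q₀ : ℝ → ℂ} (hq : MemLp q 2 (volume.restrict (Icc a b)))
    (hq₀ : MemLp q₀ 2 (volume.restrict (Icc a b))) :
    Integrable (fun t => q t - q₀ t) (volume.restrict (Icc a b)) :=
  (integrable_of_memLp_two hq).sub (integrable_of_memLp_two hq₀)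

theorem integrable_sq_sub_of_memLp_two {q q₀ : ℝ → ℂ}
    (hq : MemLp q 2 (volume.restrict (Icc a b)))
    (hq₀ : MemLp q₀ 2 (volume.restrict (Icc a b))) :
    Integrable (fun t => q t ^ 2 - q₀ t ^ 2) (volume.restrict (Icc a b)) :=
  (integrable_sq_of_memLp_two hq).sub (integrable_sq_of_memLp_two hq₀)

end Classes

section Equivalence

variable {a b : ℝ} [hab : Fact (a < b)]

/-- The parameters of the transformed system belonging to the potentials `q` and `q₀`. -/
def param (q q₀ : ℝ → ℂ) (α β : Matrix (Fin 2) (Fin 2) ℂ) : Param a b :=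
  (J (classL1 fun t => q t - q₀ t), J (classL1 fun t => q t ^ 2 - q₀ t ^ 2),
    mulL1 (J (classL1 fun t => q t - q₀ t)) (classL1 fun t => q t ^ 2 - q₀ t ^ 2)
      - mulL1 (J (classL1 fun t => q t ^ 2 - q₀ t ^ 2)) (classL1 fun t => q t - q₀ t), α, β)

theorem ext_expCI (p : CI a b) (t : ℝ) : ext (expCI p) t = Complex.exp (ext p t) := rfl

theorem ext_neg (p : CI a b) (t : ℝ) : ext (-p) t = -ext p t := rfl

theorem ext_offDiag (p r : CI a b) (t : ℝ) :
    ext (offDiag p r) t = -(ext r t * sinhc (ext p t)) := rfl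

theorem ext_commFactor (p : CI a b) (t : ℝ) :
    ext (commFactor p) t = deriv sinhc (ext p t) + sinhc (ext p t) := rfl

theorem ext_offDiag_mul_add (p r v w : CI a b) (t : ℝ) :
    ext (offDiag p r * v + expCI (-p) * w) t =
      -(ext r t * sinhc (ext p t)) * ext v t + Complex.exp (-ext p t) * ext w t := rfl

theorem ext_expCI_mul (p v : CI a b) (t : ℝ) :
    ext (expCI p * v) t = Complex.exp (ext p t) * ext v t := rfl

theorem ext_expCI_mul_sub (p r y y₁ : CI a b) (t : ℝ) :
    ext (expCI p * y₁ - offDiag p r * y) t =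
      Complex.exp (ext p t) * ext y₁ t - -(ext r t * sinhc (ext p t)) * ext y t := rfl

theorem ae_param {q q₀ : ℝ → ℂ} (hq : MemLp q 2 (volume.restrict (Icc a b)))
    (hq₀ : MemLp q₀ 2 (volume.restrict (Icc a b))) (α β : Matrix (Fin 2) (Fin 2) ℂ) :
    ∀ᵐ t ∂(volume.restrict (Icc a b)), (param (a := a) (b := b) q q₀ α β).2.2.1 t =
      ext (param (a := a) (b := b) q q₀ α β).1 t * (q t ^ 2 - q₀ t ^ 2)
        - ext (param (a := a) (b := b) q q₀ α β).2.1 t * (q t - q₀ t) := by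
  simp only [param]
  filter_upwards [Lp.coeFn_sub
      (mulL1 (J (classL1 fun t => q t - q₀ t)) (classL1 fun t => q t ^ 2 - q₀ t ^ 2) : L1 a b)
      (mulL1 (J (classL1 fun t => q t ^ 2 - q₀ t ^ 2)) (classL1 fun t => q t - q₀ t)),
    coeFn_mulL1 (J (classL1 fun t => q t - q₀ t) : CI a b) (classL1 fun t => q t ^ 2 - q₀ t ^ 2),
    coeFn_mulL1 (J (classL1 fun t => q t ^ 2 - q₀ t ^ 2) : CI a b) (classL1 fun t => q t - q₀ t),
    coeFn_classL1 (integrable_sub_of_memLp_two hq hq₀),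
    coeFn_classL1 (integrable_sq_sub_of_memLp_two hq hq₀)] with t h1 h2 h3 h4 h5
  rw [h1, Pi.sub_apply, h2, h3, h4, h5]

theorem ae_hasDerivAt_J {g : ℝ → ℂ} (h : Integrable g (volume.restrict (Icc a b))) :
    AbsolutelyContinuousOnInterval (ext (J (classL1 g : L1 a b))) a b ∧
      ∀ᵐ t ∂(volume.restrict (Icc a b)), HasDerivAt (ext (J (classL1 g : L1 a b))) (g t) t := by
  have := (eq_const_add_J_iff (J (classL1 g : L1 a b)) (classL1 g)).1 (by
    rw [J_left]; ext t; simp)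
  refine ⟨this.1, ?_⟩
  filter_upwards [this.2, coeFn_classL1 h] with t h1 h2
  rwa [← h2]

theorem ae_coeff₁ (q₀ : L1 a b) (π : Param a b) (v w : CI a b) :
    ∀ᵐ t ∂(volume.restrict (Icc a b)),
      (mulL1 v (coeff₁₁ q₀ π) + mulL1 w (coeff₁₂ π) : L1 a b) t =
        (q₀ t + ext (expCI (-π.1)) t * ext (offDiag π.1 π.2.1) t) * ext v t
          + ext (expCI (-π.1)) t * ext (expCI (-π.1)) t * ext w t := by
  filter_upwards [Lp.coeFn_add (mulL1 v (coeff₁₁ q₀ π)) (mulL1 w (coeff₁₂ π)),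
    coeFn_mulL1 v (coeff₁₁ q₀ π), coeFn_mulL1 w (coeff₁₂ π),
    Lp.coeFn_add q₀ (toLpCI 1 (expCI (-π.1) * offDiag π.1 π.2.1)),
    coeFn_toLpCI 1 (expCI (-π.1) * offDiag π.1 π.2.1),
    coeFn_toLpCI 1 (expCI (-π.1) * expCI (-π.1))] with t h1 h2 h3 h4 h5 h6
  rw [h1, Pi.add_apply, h2, h3, coeff₁₁, coeff₁₂, h4, h6, Pi.add_apply, h5, ext_mul, ext_mul]
  ring

theorem ae_coeff₂ (q₀ s₀ : L1 a b) (π : Param a b) (v w : CI a b) (f : L2 a b) :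
    ∀ᵐ t ∂(volume.restrict (Icc a b)),
      (mulL1 v (coeff₂₁ q₀ s₀ π) + mulL1 w (coeff₂₂ q₀ π) - mulL2 (expCI π.1) f : L1 a b) t =
        -(ext (expCI π.1) t * ext (commFactor π.1) t * π.2.2.1 t
          + 2 * (ext (expCI π.1) t * ext (offDiag π.1 π.2.1) t * q₀ t)
          + ext (expCI π.1) t * ext (expCI π.1) t * s₀ t
          + ext (offDiag π.1 π.2.1) t * ext (offDiag π.1 π.2.1) t) * ext v t
        + -(q₀ t + ext (offDiag π.1 π.2.1) t * ext (expCI (-π.1)) t) * ext w t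
        - ext (expCI π.1) t * f t := by
  filter_upwards [Lp.coeFn_sub (mulL1 v (coeff₂₁ q₀ s₀ π) + mulL1 w (coeff₂₂ q₀ π))
      (mulL2 (expCI π.1) f),
    Lp.coeFn_add (mulL1 v (coeff₂₁ q₀ s₀ π)) (mulL1 w (coeff₂₂ q₀ π)),
    coeFn_mulL1 v (coeff₂₁ q₀ s₀ π), coeFn_mulL1 w (coeff₂₂ q₀ π), coeFn_mulL2 (expCI π.1) f,
    Lp.coeFn_neg (mulL1 (expCI π.1 * commFactor π.1) π.2.2.1
      + (2 : ℂ) • mulL1 (expCI π.1 * offDiag π.1 π.2.1) q₀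
      + mulL1 (expCI π.1 * expCI π.1) s₀
      + toLpCI 1 (offDiag π.1 π.2.1 * offDiag π.1 π.2.1)),
    Lp.coeFn_add (mulL1 (expCI π.1 * commFactor π.1) π.2.2.1
      + (2 : ℂ) • mulL1 (expCI π.1 * offDiag π.1 π.2.1) q₀
      + mulL1 (expCI π.1 * expCI π.1) s₀)
      (toLpCI 1 (offDiag π.1 π.2.1 * offDiag π.1 π.2.1)),
    Lp.coeFn_add (mulL1 (expCI π.1 * commFactor π.1) π.2.2.1
      + (2 : ℂ) • mulL1 (expCI π.1 * offDiag π.1 π.2.1) q₀)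
      (mulL1 (expCI π.1 * expCI π.1) s₀),
    Lp.coeFn_add (mulL1 (expCI π.1 * commFactor π.1) π.2.2.1)
      ((2 : ℂ) • mulL1 (expCI π.1 * offDiag π.1 π.2.1) q₀),
    Lp.coeFn_smul (2 : ℂ) (mulL1 (expCI π.1 * offDiag π.1 π.2.1) q₀),
    coeFn_mulL1 (expCI π.1 * commFactor π.1) π.2.2.1,
    coeFn_mulL1 (expCI π.1 * offDiag π.1 π.2.1) q₀,
    coeFn_mulL1 (expCI π.1 * expCI π.1) s₀,
    coeFn_toLpCI 1 (offDiag π.1 π.2.1 * offDiag π.1 π.2.1),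
    Lp.coeFn_neg (q₀ + toLpCI 1 (offDiag π.1 π.2.1 * expCI (-π.1))),
    Lp.coeFn_add q₀ (toLpCI 1 (offDiag π.1 π.2.1 * expCI (-π.1))),
    coeFn_toLpCI 1 (offDiag π.1 π.2.1 * expCI (-π.1))]
    with t h1 h2 h3 h4 h5 h6 h7 h8 h9 h10 h11 h12 h13 h14 h15 h16 h17
  rw [h1, Pi.sub_apply, h2, Pi.add_apply, h3, h4, h5, coeff₂₁, coeff₂₂, h6, Pi.neg_apply, h7,
    Pi.add_apply, h8, Pi.add_apply, h9, Pi.add_apply, h10, Pi.smul_apply, h11, h12, h13, h14, h15,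
    Pi.neg_apply, h16, Pi.add_apply, h17]
  simp only [ext_mul, smul_eq_mul]
  ring

theorem bvpOperator_eq_iff (q₀ s₀ : L1 a b) (π : Param a b) (v w : CI a b) (f : L2 a b) :
    bvpOperator q₀ s₀ π (v, w) = (0, -J (mulL2 (expCI π.1) f)) ↔
      (boundaryForm 0 π (v, w) = 0 ∧ boundaryForm 1 π (v, w) = 0) ∧
      v = ContinuousMap.const _ (v ⟨a, left_mem⟩)
        + J (mulL1 v (coeff₁₁ q₀ π) + mulL1 w (coeff₁₂ π)) ∧
      w = ContinuousMap.const _ (w ⟨a, left_mem⟩)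
        + J (mulL1 v (coeff₂₁ q₀ s₀ π) + mulL1 w (coeff₂₂ q₀ π) - mulL2 (expCI π.1) f) := by
  have h1 : (bvpOperator q₀ s₀ π (v, w)).1 = v - ((v ⟨a, left_mem⟩ - boundaryForm 0 π (v, w)) •
      (1 : CI a b) + J (mulL1 v (coeff₁₁ q₀ π)) + J (mulL1 w (coeff₁₂ π))) := by
    simp [bvpOperator, compactPart, cst, ev, volterra_apply]
    ext t
    simp
  have h2 : (bvpOperator q₀ s₀ π (v, w)).2 = w - ((w ⟨a, left_mem⟩ - boundaryForm 1 π (v, w)) •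
      (1 : CI a b) + J (mulL1 v (coeff₂₁ q₀ s₀ π)) + J (mulL1 w (coeff₂₂ q₀ π))) := by
    simp [bvpOperator, compactPart, cst, ev, volterra_apply]
    ext t
    simp
  have hc (c : ℂ) : ContinuousMap.const (Icc a b) c = c • (1 : CI a b) := by ext; simp
  rw [Prod.ext_iff, h1, h2, map_add, map_sub, map_add, hc, hc]
  constructor
  · rintro ⟨e1, e2⟩
    have b1 : boundaryForm 0 π (v, w) = 0 := by
      have := congrArg (fun u : CI a b => u ⟨a, left_mem⟩) e1
      simpa [J_left] using this
    have b2 : boundaryForm 1 π (v, w) = 0 := by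
      have := congrArg (fun u : CI a b => u ⟨a, left_mem⟩) e2
      simpa [J_left] using this
    rw [b1, sub_zero] at e1
    rw [b2, sub_zero] at e2
    refine ⟨⟨b1, b2⟩, ?_, ?_⟩
    · rw [sub_eq_zero] at e1
      rw [← add_assoc]; exact e1
    · simp only at e2
      rw [sub_eq_iff_eq_add] at e2
      refine e2.trans ?_
      abel
  · rintro ⟨⟨b1, b2⟩, e1, e2⟩
    rw [b1, b2, sub_zero, sub_zero]
    refine ⟨?_, ?_⟩
    · rw [sub_eq_zero, add_assoc]; exact e1
    · simp only
      rw [sub_eq_iff_eq_add]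
      refine e2.trans ?_
      abel

theorem boundaryForm_apply (i : Fin 2) (q q₀ : ℝ → ℂ) (α β : Matrix (Fin 2) (Fin 2) ℂ)
    (v w : CI a b) :
    boundaryForm i (param q q₀ α β) (v, w) =
      (α *ᵥ ![ext (expCI (param (a := a) (b := b) q q₀ α β).1 * v) a,
          ext (offDiag (param q q₀ α β).1 (param q q₀ α β).2.1 * v
            + expCI (-(param q q₀ α β).1) * w) a]
        + β *ᵥ ![ext (expCI (param q q₀ α β).1 * v) b,
          ext (offDiag (param q q₀ α β).1 (param q q₀ α β).2.1 * v
            + expCI (-(param q q₀ α β).1) * w) b]) i := by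
  have hp : (param (a := a) (b := b) q q₀ α β).1 ⟨a, left_mem⟩ = 0 := J_left _
  have hr : (param (a := a) (b := b) q q₀ α β).2.1 ⟨a, left_mem⟩ = 0 := J_left _
  simp only [ext_of_mem _ left_mem, ext_of_mem _ right_mem, boundaryForm]
  fin_cases i <;>
  · simp [ev, expCI, offDiag, hp, hr]
    simp only [param]
    ring

/-- A solution of the integral equation gives a solution of the boundary value problem. -/
theorem inGraph_of_bvpOperator {q q₀ : ℝ → ℂ} (hq : MemLp q 2 (volume.restrict (Icc a b)))
    (hq₀ : MemLp q₀ 2 (volume.restrict (Icc a b))) (α β : Matrix (Fin 2) (Fin 2) ℂ) (μ : ℂ)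
    {v w : CI a b} {f : L2 a b}
    (h : bvpOperator (classL1 q₀) (classL1 fun t => q₀ t ^ 2 + μ) (param q q₀ α β) (v, w) =
      (0, -J (mulL2 (expCI (param q q₀ α β).1) f))) :
    InGraph a b q α β (toLpCI 2 (expCI (param (a := a) (b := b) q q₀ α β).1 * v))
      (f + μ • toLpCI 2 (expCI (param (a := a) (b := b) q q₀ α β).1 * v)) := by
  obtain ⟨⟨b1, b2⟩, e1, e2⟩ := (bvpOperator_eq_iff _ _ _ v w f).1 h
  obtain ⟨av, dv⟩ := (eq_const_add_J_iff _ _).1 e1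
  obtain ⟨aw, dw⟩ := (eq_const_add_J_iff _ _).1 e2
  have ip := integrable_sub_of_memLp_two hq hq₀
  have ir := integrable_sq_sub_of_memLp_two hq hq₀
  have is : Integrable (fun t => q₀ t ^ 2 + μ) (volume.restrict (Icc a b)) :=
    (integrable_sq_of_memLp_two hq₀).add (integrable_const μ)
  obtain ⟨ap, dp⟩ := ae_hasDerivAt_J ip
  obtain ⟨ar, dr⟩ := ae_hasDerivAt_J ir
  set π : Param a b := param q q₀ α β with hπ
  have aE : AbsolutelyContinuousOnInterval (ext (expCI π.1)) a b :=
    AbsolutelyContinuousOnInterval.comp_entire Complex.differentiable_exp ap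
  have aF : AbsolutelyContinuousOnInterval (ext (expCI (-π.1))) a b :=
    AbsolutelyContinuousOnInterval.comp_entire Complex.differentiable_exp ap.neg
  have ax : AbsolutelyContinuousOnInterval (ext (offDiag π.1 π.2.1)) a b :=
    (ar.smul (AbsolutelyContinuousOnInterval.comp_entire differentiable_sinhc ap)).neg
  have key : ∀ᵐ t ∂(volume.restrict (Icc a b)),
      HasDerivAt (ext (expCI π.1 * v)) (q t * ext (expCI π.1 * v) t
          + ext (offDiag π.1 π.2.1 * v + expCI (-π.1) * w) t) t ∧
        HasDerivAt (ext (offDiag π.1 π.2.1 * v + expCI (-π.1) * w))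
          (-(f t + μ * ext (expCI π.1 * v) t)
            - q t * ext (offDiag π.1 π.2.1 * v + expCI (-π.1) * w) t
            - q t ^ 2 * ext (expCI π.1 * v) t) t := by
    filter_upwards [dv, dw, dp, dr, ae_coeff₁ (classL1 q₀) π v w,
      ae_coeff₂ (classL1 q₀) (classL1 fun t => q₀ t ^ 2 + μ) π v w f,
      coeFn_classL1 (integrable_of_memLp_two hq₀), coeFn_classL1 is,
      ae_param hq hq₀ α β]
      with t h1 h2 h3 h4 h5 h6 h7 h8 h9
    rw [← hπ] at h9
    rw [h7] at h5
    rw [h7, h9] at h6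
    simp only [ext_expCI, ext_neg, ext_offDiag, ext_commFactor] at h5 h6
    have := hasDerivAt_of_transformed h3 h4 h1 h2 h8 h5 h6
    rw [funext (ext_expCI_mul π.1 v), funext (ext_offDiag_mul_add π.1 π.2.1 v w)]
    exact this
  refine ⟨ext (expCI π.1 * v), ext (offDiag π.1 π.2.1 * v + expCI (-π.1) * w),
    fun t => f t + μ * ext (expCI π.1 * v) t, ⟨?_, ?_, ?_, ?_⟩, coeFn_toLpCI _ _, ?_, ?_⟩
  · exact aE.smul av
  · exact (ax.smul av).add (aF.smul aw)
  · filter_upwards [key] with t ht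
    exact ⟨_, ht.1, by ring⟩
  · filter_upwards [key] with t ht
    exact ⟨_, ht.2, by ring⟩
  · filter_upwards [Lp.coeFn_add f (μ • toLpCI 2 (expCI π.1 * v)),
      Lp.coeFn_smul μ (toLpCI 2 (expCI π.1 * v)), coeFn_toLpCI 2 (expCI π.1 * v)] with t h1 h2 h3
    rw [h1, Pi.add_apply, h2, Pi.smul_apply, h3, smul_eq_mul]
  · rw [hπ, boundaryForm_apply] at b1 b2
    funext i
    fin_cases i
    · exact b1
    · exact b2

/-- A solution of the boundary value problem comes from a solution of the integral equation. -/
theorem exists_bvpOperator_of_inGraph {q q₀ : ℝ → ℂ} (hq : MemLp q 2 (volume.restrict (Icc a b)))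
    (hq₀ : MemLp q₀ 2 (volume.restrict (Icc a b))) (α β : Matrix (Fin 2) (Fin 2) ℂ) (μ : ℂ)
    {u g : L2 a b} (h : InGraph a b q α β u g) :
    ∃ v w : CI a b,
      bvpOperator (classL1 q₀) (classL1 fun t => q₀ t ^ 2 + μ) (param q q₀ α β) (v, w) =
        (0, -J (mulL2 (expCI (param q q₀ α β).1) (g - μ • u))) ∧
      toLpCI 2 (expCI (param (a := a) (b := b) q q₀ α β).1 * v) = u := by
  obtain ⟨y, y₁, y₂, H, hu, hg, hB⟩ := h
  have ip := integrable_sub_of_memLp_two hq hq₀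
  have ir := integrable_sq_sub_of_memLp_two hq hq₀
  have is : Integrable (fun t => q₀ t ^ 2 + μ) (volume.restrict (Icc a b)) :=
    (integrable_sq_of_memLp_two hq₀).add (integrable_const μ)
  obtain ⟨ap, dp⟩ := ae_hasDerivAt_J ip
  obtain ⟨ar, dr⟩ := ae_hasDerivAt_J ir
  set π : Param a b := param q q₀ α β with hπ
  have restr : ∀ z : ℝ → ℂ, AbsolutelyContinuousOnInterval z a b →
      ∃ Z : CI a b, EqOn z (ext Z) (Icc a b) := fun z hz => by
    have hc := hz.continuousOn
    rw [uIcc_of_le hab.out.le] at hc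
    exact ⟨⟨fun t => z t, continuousOn_iff_continuous_domRestrict.1 hc⟩,
      fun t ht => by rw [ext_of_mem _ ht]; rfl⟩
  obtain ⟨Y, hY⟩ := restr y H.ac₀
  obtain ⟨Y₁, hY₁⟩ := restr y₁ H.ac₁
  have aY : AbsolutelyContinuousOnInterval (ext Y) a b :=
    AbsolutelyContinuousOnInterval.congr H.ac₀ (by rwa [uIcc_of_le hab.out.le])
  have aY₁ : AbsolutelyContinuousOnInterval (ext Y₁) a b :=
    AbsolutelyContinuousOnInterval.congr H.ac₁ (by rwa [uIcc_of_le hab.out.le])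
  have aE : AbsolutelyContinuousOnInterval (ext (expCI π.1)) a b :=
    AbsolutelyContinuousOnInterval.comp_entire Complex.differentiable_exp ap
  have aF : AbsolutelyContinuousOnInterval (ext (expCI (-π.1))) a b :=
    AbsolutelyContinuousOnInterval.comp_entire Complex.differentiable_exp ap.neg
  have ax : AbsolutelyContinuousOnInterval (ext (offDiag π.1 π.2.1)) a b :=
    (ar.smul (AbsolutelyContinuousOnInterval.comp_entire differentiable_sinhc ap)).neg
  have hEF : expCI π.1 * expCI (-π.1) = 1 := by
    ext t
    simp [expCI, ← Complex.exp_add]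
  set v : CI a b := expCI (-π.1) * Y with hv
  set w : CI a b := expCI π.1 * Y₁ - offDiag π.1 π.2.1 * Y with hw
  have hYv : expCI π.1 * v = Y := by rw [hv, ← mul_assoc, hEF, one_mul]
  have hY₁w : offDiag π.1 π.2.1 * v + expCI (-π.1) * w = Y₁ := by
    rw [hv, hw]
    linear_combination Y₁ * hEF
  have huY : u =ᵐ[volume.restrict (Icc a b)] ext Y := by
    filter_upwards [hu, ae_mem_Ioo] with t ht hm
    rw [ht, hY (Ioo_subset_Icc_self hm)]
  have key : ∀ᵐ t ∂(volume.restrict (Icc a b)),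
      HasDerivAt (ext v) ((mulL1 v (coeff₁₁ (classL1 q₀) π) + mulL1 w (coeff₁₂ π) : L1 a b) t) t ∧
      HasDerivAt (ext w) ((mulL1 v (coeff₂₁ (classL1 q₀) (classL1 fun t => q₀ t ^ 2 + μ) π)
        + mulL1 w (coeff₂₂ (classL1 q₀) π) - mulL2 (expCI π.1) (g - μ • u) : L1 a b) t) t := by
    filter_upwards [H.eq₁, H.eq₂, ae_mem_Ioo, huY, hg, dp, dr, ae_coeff₁ (classL1 q₀) π v w,
      ae_coeff₂ (classL1 q₀) (classL1 fun t => q₀ t ^ 2 + μ) π v w (g - μ • u),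
      coeFn_classL1 (integrable_of_memLp_two hq₀), coeFn_classL1 is,
      ae_param hq hq₀ α β,
      Lp.coeFn_sub g (μ • u), Lp.coeFn_smul μ u]
      with t hy hy₁ hm h1 h2 h3 h4 h5 h6 h7 h8 h9 h14 h15
    obtain ⟨y', hy', ey⟩ := hy
    obtain ⟨y₁', hy₁', ey₁⟩ := hy₁
    have hI : Icc a b ∈ 𝓝 t := Icc_mem_nhds hm.1 hm.2
    have dY := hy'.congr_of_eventuallyEq (hY.symm.eventuallyEq_of_mem hI)
    have dY₁ := hy₁'.congr_of_eventuallyEq (hY₁.symm.eventuallyEq_of_mem hI)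
    have hf : (g - μ • u : L2 a b) t = y₂ t - μ * ext Y t := by
      rw [h14, Pi.sub_apply, h15, Pi.smul_apply, h1, h2, smul_eq_mul]
    have hm' := Ioo_subset_Icc_self hm
    rw [hY hm', hY₁ hm'] at ey₁
    rw [hY hm', hY₁ hm'] at ey
    rw [← hπ] at h9
    have key := hasDerivAt_transformed (f := y₂ t - μ * ext Y t) (μ := μ) h3 h4 dY dY₁ h8
      (by rw [ey]; ring) (by rw [ey₁]; ring)
    rw [h7] at h5
    rw [h7, h9, hf] at h6
    simp only [hv, hw, ext_expCI, ext_neg, ext_offDiag, ext_commFactor, ext_expCI_mul_sub,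
      ext_mul] at h5 h6
    exact ⟨key.1.congr_deriv h5.symm, key.2.congr_deriv h6.symm⟩
  refine ⟨v, w, (bvpOperator_eq_iff _ _ _ v w _).2 ⟨?_, ?_, ?_⟩, ?_⟩
  · have hb (i : Fin 2) : boundaryForm i π (v, w) = 0 := by
      rw [hπ, boundaryForm_apply, ← hπ, hYv, hY₁w, ← hY left_mem, ← hY right_mem, ← hY₁ left_mem,
        ← hY₁ right_mem, hB]
      rfl
    exact ⟨hb 0, hb 1⟩
  · exact (eq_const_add_J_iff _ _).2 ⟨aF.smul aY, key.mono fun t ht => ht.1⟩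
  · exact (eq_const_add_J_iff _ _).2 ⟨(aE.smul aY₁).sub (ax.smul aY), key.mono fun t ht => ht.2⟩
  · rw [hYv]
    exact Lp.ext ((coeFn_toLpCI 2 Y).trans huY.symm)

theorem eq_zero_of_ext_ae_eq_zero {u : CI a b} (h : ext u =ᵐ[volume.restrict (Icc a b)] 0) :
    u = 0 := by
  have := Measure.eqOn_Icc_of_ae_eq volume hab.out.ne h (ext u).continuous.continuousOn
    continuousOn_const
  ext t
  rw [← ext_of_mem u t.2]
  exact this t.2

/-- If the spectral parameter belongs to the resolvent set, the integral equation is uniquely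
solvable. -/
theorem isUnit_bvpOperator_of_mem_resolventSet {q q₀ : ℝ → ℂ}
    (hq : MemLp q 2 (volume.restrict (Icc a b))) (hq₀ : MemLp q₀ 2 (volume.restrict (Icc a b)))
    (α β : Matrix (Fin 2) (Fin 2) ℂ) {μ : ℂ} (hμ : μ ∈ resolventSet (slOperator a b q α β)) :
    IsUnit (bvpOperator (a := a) (b := b) (classL1 q₀) (classL1 fun t => q₀ t ^ 2 + μ)
      (param q q₀ α β)) := by
  refine isUnit_bvpOperator_of_ker _ _ _ ?_
  rintro ⟨v, w⟩ h
  obtain ⟨S, hS⟩ := hμ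
  have h' : bvpOperator (classL1 q₀) (classL1 fun t => q₀ t ^ 2 + μ) (param q q₀ α β) (v, w) =
      (0, -J (mulL2 (expCI (param (a := a) (b := b) q q₀ α β).1) 0)) := by
    rw [h, map_zero, map_zero, neg_zero]; rfl
  have hG := inGraph_of_bvpOperator hq hq₀ α β μ h'
  rw [← slOperator_mem_graph, LinearPMap.mem_graph_iff] at hG
  obtain ⟨y, hy, hLy⟩ := hG
  simp only at hy hLy
  have h0 : toLpCI 2 (expCI (param (a := a) (b := b) q q₀ α β).1 * v) = 0 := by
    have := hS.2 y
    rwa [hLy, hy, zero_add, sub_self, map_zero, eq_comm] at this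
  have hEv : expCI (param (a := a) (b := b) q q₀ α β).1 * v = 0 := by
    refine eq_zero_of_ext_ae_eq_zero ((coeFn_toLpCI 2 _).symm.trans ?_)
    rw [h0]
    exact Lp.coeFn_zero _ _ _
  have hv : v = 0 := by
    ext t
    have := congrArg (fun u : CI a b => u t) hEv
    exact (mul_eq_zero.1 this).resolve_left (Complex.exp_ne_zero _)
  subst hv
  obtain ⟨-, e1, -⟩ := (bvpOperator_eq_iff _ _ _ _ _ _).1 h'
  obtain ⟨-, d⟩ := (eq_const_add_J_iff _ _).1 e1
  have hw : w = 0 := by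
    refine eq_zero_of_ext_ae_eq_zero ?_
    filter_upwards [d, ae_coeff₁ (classL1 q₀) (param q q₀ α β) 0 w] with t h1 h2
    have h3 : HasDerivAt (ext (0 : CI a b)) 0 t := by
      rw [map_zero]; exact hasDerivAt_const t 0
    have h4 := h1.unique h3
    rw [h2, map_zero] at h4
    simpa [ext_apply, expCI, Complex.exp_ne_zero] using h4
  rw [hw]
  rfl

/-- The solution operator is the resolvent. -/
theorem isResolventAt_solutionOperator {q q₀ : ℝ → ℂ}
    (hq : MemLp q 2 (volume.restrict (Icc a b))) (hq₀ : MemLp q₀ 2 (volume.restrict (Icc a b)))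
    (α β : Matrix (Fin 2) (Fin 2) ℂ) (μ : ℂ)
    (hU : IsUnit (bvpOperator (a := a) (b := b) (classL1 q₀) (classL1 fun t => q₀ t ^ 2 + μ)
      (param q q₀ α β))) :
    IsResolventAt (slOperator a b q α β) μ
      (solutionOperator (classL1 q₀) (classL1 fun t => q₀ t ^ 2 + μ) (param q q₀ α β)) := by
  have key (f : L2 a b) (v w : CI a b)
      (h : bvpOperator (classL1 q₀) (classL1 fun t => q₀ t ^ 2 + μ) (param q q₀ α β) (v, w) =
        (0, -J (mulL2 (expCI (param q q₀ α β).1) f))) :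
      solutionOperator (classL1 q₀) (classL1 fun t => q₀ t ^ 2 + μ) (param q q₀ α β) f =
        toLpCI 2 (expCI (param (a := a) (b := b) q q₀ α β).1 * v) := by
    have h1 := congrArg (fun T : CI a b × CI a b →L[ℂ] CI a b × CI a b => T (v, w))
      (Ring.inverse_mul_cancel _ hU)
    simp only [mul_apply_eq_comp, one_apply_eq_self] at h1
    rw [h] at h1
    have h2 : solutionOperator (classL1 q₀) (classL1 fun t => q₀ t ^ 2 + μ) (param q q₀ α β) f =
        toLpCI 2 (expCI (param (a := a) (b := b) q q₀ α β).1 *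
          (Ring.inverse (bvpOperator (classL1 q₀) (classL1 fun t => q₀ t ^ 2 + μ)
            (param q q₀ α β)) (0, -J (mulL2 (expCI (param q q₀ α β).1) f))).1) := rfl
    rw [h2, h1]
  constructor
  · intro f
    obtain ⟨⟨v, w⟩, hvw⟩ : ∃ z, bvpOperator (classL1 q₀) (classL1 fun t => q₀ t ^ 2 + μ)
        (param q q₀ α β) z = (0, -J (mulL2 (expCI (param q q₀ α β).1) f)) := by
      refine ⟨Ring.inverse (bvpOperator (classL1 q₀) (classL1 fun t => q₀ t ^ 2 + μ)
        (param q q₀ α β)) (0, -J (mulL2 (expCI (param q q₀ α β).1) f)), ?_⟩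
      have h1 := congrArg (fun T : CI a b × CI a b →L[ℂ] CI a b × CI a b =>
        T (0, -J (mulL2 (expCI (param q q₀ α β).1) f))) (Ring.mul_inverse_cancel _ hU)
      exact h1
    have hG := inGraph_of_bvpOperator hq hq₀ α β μ hvw
    rw [← key f v w hvw, ← slOperator_mem_graph, LinearPMap.mem_graph_iff] at hG
    obtain ⟨y, hy, hLy⟩ := hG
    simp only at hy hLy
    refine ⟨hy ▸ y.2, ?_⟩
    have : (⟨_, hy ▸ y.2⟩ : (slOperator a b q α β).domain) = y := Subtype.ext hy.symm
    rw [this, hLy, add_sub_cancel_right]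
  · intro y
    have hG : InGraph a b q α β y (slOperator a b q α β y) :=
      (slOperator_mem_graph a b q α β _ _).1 (LinearPMap.mem_graph _ y)
    obtain ⟨v, w, h1, h2⟩ := exists_bvpOperator_of_inGraph hq hq₀ α β μ hG
    rw [key _ v w h1, h2]

end Equivalence


section Norms

theorem enorm_le_supNorm {a b : ℝ} (g : ℝ → ℂ) {t : ℝ} (ht : t ∈ Icc a b) :
    ‖g t‖ₑ ≤ supNorm a b g := le_iSup₂ (f := fun t (_ : t ∈ Icc a b) => ‖g t‖ₑ) t ht

theorem matR_eq (q : ℝ → ℝ → ℂ) (ε t : ℝ) :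
    matR q ε t = !![q ε t - q 0 t, 0; -(q ε t ^ 2 - q 0 t ^ 2), -(q ε t - q 0 t)] := by
  ext i j
  fin_cases i <;> fin_cases j <;> simp [matR, systemMatrix] <;> ring

theorem matPrimitive_matR_eq (a : ℝ) (q : ℝ → ℝ → ℂ) (ε t : ℝ) :
    matPrimitive a (matR q ε) t =
      !![primitive a (fun x => q ε x - q 0 x) t, 0;
        -primitive a (fun x => q ε x ^ 2 - q 0 x ^ 2) t,
        -primitive a (fun x => q ε x - q 0 x) t] := by
  ext i j
  fin_cases i <;> fin_cases j <;> simp [matPrimitive, primitive, matR_eq] <;>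
    rw [← intervalIntegral.integral_neg] <;> simp only [neg_sub]

theorem eLpNorm_entry_le_matL1Norm (a b : ℝ) (M : ℝ → Matrix (Fin 2) (Fin 2) ℂ) (i j : Fin 2) :
    eLpNorm (fun t => M t i j) 1 (volume.restrict (Icc a b)) ≤ matL1Norm a b M :=
  (Finset.single_le_sum (f := fun j => eLpNorm (fun t => M t i j) 1 (volume.restrict (Icc a b)))
    (fun _ _ => zero_le) (Finset.mem_univ j)).trans
  (Finset.single_le_sum
    (f := fun i => ∑ j, eLpNorm (fun t => M t i j) 1 (volume.restrict (Icc a b)))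
    (fun _ _ => zero_le) (Finset.mem_univ i))

/-- Each of the three matrices controls the commutator term `r' p - p' r`. -/
theorem norm_commutator_le (a : ℝ) (q : ℝ → ℝ → ℂ) (ε t : ℝ) :
    ‖primitive a (fun x => q ε x - q 0 x) t * (q ε t ^ 2 - q 0 t ^ 2)
        - primitive a (fun x => q ε x ^ 2 - q 0 x ^ 2) t * (q ε t - q 0 t)‖ =
      ‖(matR q ε t * matPrimitive a (matR q ε) t) 1 0‖ ∧
    ‖primitive a (fun x => q ε x - q 0 x) t * (q ε t ^ 2 - q 0 t ^ 2)
        - primitive a (fun x => q ε x ^ 2 - q 0 x ^ 2) t * (q ε t - q 0 t)‖ =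
      ‖(matPrimitive a (matR q ε) t * matR q ε t) 1 0‖ ∧
    ‖primitive a (fun x => q ε x - q 0 x) t * (q ε t ^ 2 - q 0 t ^ 2)
        - primitive a (fun x => q ε x ^ 2 - q 0 x ^ 2) t * (q ε t - q 0 t)‖ ≤
      ‖(matR q ε t * matPrimitive a (matR q ε) t
        - matPrimitive a (matR q ε) t * matR q ε t) 1 0‖ := by
  rw [matPrimitive_matR_eq, matR_eq]
  generalize primitive a (fun x => q ε x - q 0 x) t = P
  generalize primitive a (fun x => q ε x ^ 2 - q 0 x ^ 2) t = Q
  generalize q ε t ^ 2 - q 0 t ^ 2 = r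
  generalize q ε t - q 0 t = p
  have h1 : (!![p, 0; -r, -p] * !![P, 0; -Q, -P]) 1 0 = -(P * r - Q * p) := by
    simp [Matrix.mul_apply, Fin.sum_univ_two]; ring
  have h2 : (!![P, 0; -Q, -P] * !![p, 0; -r, -p]) 1 0 = P * r - Q * p := by
    simp [Matrix.mul_apply, Fin.sum_univ_two]; ring
  refine ⟨by rw [h1, norm_neg], by rw [h2], ?_⟩
  rw [Matrix.sub_apply, h1, h2, ← neg_add', norm_neg, ← two_mul, norm_mul]
  have := norm_nonneg (P * r - Q * p)
  simp only [Complex.norm_ofNat]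
  linarith

theorem tendsto_eLpNorm_commutator {a b : ℝ} {q : ℝ → ℝ → ℂ}
    (h : CondI a b q ∨ CondII a b q ∨ CondIII a b q) :
    Tendsto (fun ε => eLpNorm (fun t =>
      primitive a (fun x => q ε x - q 0 x) t * (q ε t ^ 2 - q 0 t ^ 2)
        - primitive a (fun x => q ε x ^ 2 - q 0 x ^ 2) t * (q ε t - q 0 t)) 1
        (volume.restrict (Icc a b))) (𝓝[>] (0 : ℝ)) (𝓝 0) := by
  rcases h with h | h | h
  · refine tendsto_of_tendsto_of_tendsto_of_le_of_le tendsto_const_nhds h (fun _ => zero_le)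
      fun ε => (eLpNorm_mono fun t => (norm_commutator_le a q ε t).1.le).trans
        (eLpNorm_entry_le_matL1Norm a b _ 1 0)
  · refine tendsto_of_tendsto_of_tendsto_of_le_of_le tendsto_const_nhds h (fun _ => zero_le)
      fun ε => (eLpNorm_mono fun t => (norm_commutator_le a q ε t).2.1.le).trans
        (eLpNorm_entry_le_matL1Norm a b _ 1 0)
  · refine tendsto_of_tendsto_of_tendsto_of_le_of_le tendsto_const_nhds h (fun _ => zero_le)
      fun ε => (eLpNorm_mono fun t => (norm_commutator_le a q ε t).2.2).trans
        (eLpNorm_entry_le_matL1Norm a b _ 1 0)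

end Norms

section BoundedPotentials

theorem matL1Norm_le_of_entries {a b : ℝ} {q : ℝ → ℝ → ℂ} {ε : ℝ}
    (hq : MemLp (q ε) 2 (volume.restrict (Icc a b)))
    (hq₀ : MemLp (q 0) 2 (volume.restrict (Icc a b)))
    {C : ℝ≥0∞} {M : ℝ → Matrix (Fin 2) (Fin 2) ℂ}
    (hM : ∀ t ∈ Icc a b, ∀ i j,
      ‖M t i j‖ₑ ≤ C * (‖q ε t - q 0 t‖ₑ + ‖q ε t ^ 2 - q 0 t ^ 2‖ₑ)) :
    matL1Norm a b M ≤ 4 * (C * (eLpNorm (fun t => q ε t - q 0 t) 1 (volume.restrict (Icc a b))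
      + eLpNorm (fun t => q ε t ^ 2 - q 0 t ^ 2) 1 (volume.restrict (Icc a b)))) := by
  have h1 := (integrable_sub_of_memLp_two hq hq₀).aestronglyMeasurable.enorm
  have h2 := (integrable_sq_sub_of_memLp_two hq hq₀).aestronglyMeasurable.enorm
  have key (i j : Fin 2) : eLpNorm (fun t => M t i j) 1 (volume.restrict (Icc a b)) ≤
      C * (eLpNorm (fun t => q ε t - q 0 t) 1 (volume.restrict (Icc a b))
        + eLpNorm (fun t => q ε t ^ 2 - q 0 t ^ 2) 1 (volume.restrict (Icc a b))) := by
    simp only [eLpNorm_one_eq_lintegral_enorm]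
    rw [← lintegral_add_left' h1]
    refine le_trans ?_ (lintegral_const_mul'' C (h1.add h2)).le
    refine lintegral_mono_ae ?_
    filter_upwards [ae_restrict_mem measurableSet_Icc] with t ht
    exact hM t ht i j
  calc matL1Norm a b M ≤ ∑ i : Fin 2, ∑ j : Fin 2, _ :=
        Finset.sum_le_sum fun i _ => Finset.sum_le_sum fun j _ => key i j
    _ = _ := by simp only [Finset.sum_const, Finset.card_univ, Fintype.card_fin, nsmul_eq_mul,
        ← mul_assoc]; norm_num

theorem enorm_mul_add_mul_le {A B P Q : ℂ} {m s : ℝ≥0∞} (hA : ‖A‖ₑ ≤ m) (hB : ‖B‖ₑ ≤ m)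
    (hs : ‖P‖ₑ + ‖Q‖ₑ ≤ s) : ‖A * P + B * Q‖ₑ ≤ s * m := by
  refine (enorm_add_le _ _).trans ?_
  rw [enorm_mul, enorm_mul]
  calc ‖A‖ₑ * ‖P‖ₑ + ‖B‖ₑ * ‖Q‖ₑ ≤ m * ‖P‖ₑ + m * ‖Q‖ₑ := by gcongr
    _ = (‖P‖ₑ + ‖Q‖ₑ) * m := by ring
    _ ≤ s * m := by gcongr

theorem enorm_entries_le {p r P Q : ℂ} {s : ℝ≥0∞} (hs : ‖P‖ₑ + ‖Q‖ₑ ≤ s) (i j : Fin 2) :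
    ‖(!![p, 0; -r, -p] * !![P, 0; -Q, -P]) i j‖ₑ ≤ s * (‖p‖ₑ + ‖r‖ₑ) ∧
      ‖(!![P, 0; -Q, -P] * !![p, 0; -r, -p]) i j‖ₑ ≤ s * (‖p‖ₑ + ‖r‖ₑ) := by
  have hp : ‖p‖ₑ ≤ ‖p‖ₑ + ‖r‖ₑ := le_self_add
  have hr : ‖-r‖ₑ ≤ ‖p‖ₑ + ‖r‖ₑ := by rw [enorm_neg]; exact le_add_self
  have hr' : ‖r‖ₑ ≤ ‖p‖ₑ + ‖r‖ₑ := le_add_self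
  have hp' : ‖-p‖ₑ ≤ ‖p‖ₑ + ‖r‖ₑ := by rw [enorm_neg]; exact le_self_add
  have h0 : ‖(0 : ℂ)‖ₑ ≤ ‖p‖ₑ + ‖r‖ₑ := by simp
  have e1 := enorm_mul_add_mul_le hp h0 hs
  have e2 := enorm_mul_add_mul_le hr hp hs
  have e3 := enorm_mul_add_mul_le hr' hp' hs
  rw [zero_mul, add_zero] at e1
  fin_cases i <;> fin_cases j <;> refine ⟨?_, ?_⟩ <;>
    simp only [Matrix.mul_apply, Fin.sum_univ_two, Fin.zero_eta, Fin.mk_one, Matrix.of_apply,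
      Matrix.cons_val', Matrix.cons_val_zero, Matrix.cons_val_one, Matrix.cons_val_fin_one,
      mul_zero, zero_mul, add_zero, zero_add, neg_mul_neg, enorm_zero, zero_le, e1, mul_comm P p]
  · exact e2
  · convert e3 using 2; ring

theorem eLpNorm_one_sub_le {a b : ℝ} {f g : ℝ → ℂ} {c d : ℝ≥0∞}
    (hf : AEStronglyMeasurable f (volume.restrict (Icc a b)))
    (hg : AEStronglyMeasurable g (volume.restrict (Icc a b)))
    (hc : eLpNorm f 1 (volume.restrict (Icc a b)) ≤ c)
    (hd : eLpNorm g 1 (volume.restrict (Icc a b)) ≤ d) :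
    eLpNorm (fun t => f t - g t) 1 (volume.restrict (Icc a b)) ≤ c + d :=
  (eLpNorm_sub_le hf hg le_rfl).trans (add_le_add hc hd)

theorem eLpNorm_sq_le {a b : ℝ} {f : ℝ → ℂ}
    (hf : AEStronglyMeasurable f (volume.restrict (Icc a b))) :
    eLpNorm (fun t => f t ^ 2) 1 (volume.restrict (Icc a b)) ≤
      eLpNorm f 2 (volume.restrict (Icc a b)) * eLpNorm f 2 (volume.restrict (Icc a b)) := by
  have := eLpNorm_smul_le_mul_eLpNorm (p := 2) (q := 2) (r := 1) hf hf
  have he : (fun t => f t ^ 2) = f • f := funext fun t => sq (f t)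
  rwa [he]

theorem eLpNorm_one_le {a b : ℝ} {f : ℝ → ℂ}
    (hf : AEStronglyMeasurable f (volume.restrict (Icc a b))) :
    eLpNorm f 1 (volume.restrict (Icc a b)) ≤
      eLpNorm f 2 (volume.restrict (Icc a b)) *
        (volume.restrict (Icc a b)) univ ^ (1 / (1 : ℝ≥0∞).toReal - 1 / (2 : ℝ≥0∞).toReal) :=
  eLpNorm_le_eLpNorm_mul_rpow_measure_univ one_le_two hf

/-- A bound on the `L₂` norms of the potentials implies all three commutator conditions. -/
theorem conditions_of_boundedL2 {a b ε₀ : ℝ} (hε₀ : 0 < ε₀) {q : ℝ → ℝ → ℂ}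
    (hq : ∀ ε ∈ Icc (0 : ℝ) ε₀, MemLp (q ε) 2 (volume.restrict (Icc a b)))
    (h2 : Tendsto (fun ε => supNorm a b (primitive a fun x => q ε x - q 0 x)) (𝓝[>] (0 : ℝ)) (𝓝 0))
    (h3 : Tendsto (fun ε => supNorm a b (primitive a fun x => q ε x ^ 2 - q 0 x ^ 2))
      (𝓝[>] (0 : ℝ)) (𝓝 0))
    (hb : BoundedL2 a b q) : CondI a b q ∧ CondII a b q ∧ CondIII a b q := by
  obtain ⟨C, hC⟩ := hb
  have hq₀ := hq 0 ⟨le_rfl, hε₀.le⟩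
  set θ : ℝ≥0∞ :=
    (volume.restrict (Icc a b)) univ ^ (1 / (1 : ℝ≥0∞).toReal - 1 / (2 : ℝ≥0∞).toReal) with hθ
  have hθt : θ ≠ ∞ := ENNReal.rpow_ne_top_of_nonneg (by norm_num) (measure_ne_top _ _)
  set D : ℝ≥0∞ := eLpNorm (q 0) 2 (volume.restrict (Icc a b))
  have hD : D ≠ ∞ := hq₀.2.ne
  set K : ℝ≥0∞ := (C * θ + D * θ) + (C * C + D * D)
  have hK : K ≠ ∞ := by
    simp only [K]
    finiteness
  set s : ℝ → ℝ≥0∞ := fun ε => supNorm a b (primitive a fun x => q ε x - q 0 x)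
    + supNorm a b (primitive a fun x => q ε x ^ 2 - q 0 x ^ 2)
  have hs : Tendsto (fun ε => 4 * ((s ε + s ε) * K)) (𝓝[>] (0 : ℝ)) (𝓝 0) := by
    have h := h2.add h3
    have h' := ENNReal.Tendsto.mul_const (h.add h) (Or.inr hK)
    have h'' := ENNReal.Tendsto.const_mul (a := 4) h' (Or.inr (by norm_num))
    simpa using h''
  have hev : ∀ᶠ ε in 𝓝[>] (0 : ℝ), ε ∈ Icc 0 ε₀ :=
    mem_of_superset (Ioc_mem_nhdsGT hε₀) Ioc_subset_Icc_self
  have main : ∀ M : ℝ → ℝ → Matrix (Fin 2) (Fin 2) ℂ,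
      (∀ ε, ∀ t ∈ Icc a b, ∀ i j,
        ‖M ε t i j‖ₑ ≤ (s ε + s ε) * (‖q ε t - q 0 t‖ₑ + ‖q ε t ^ 2 - q 0 t ^ 2‖ₑ)) →
      Tendsto (fun ε => matL1Norm a b (M ε)) (𝓝[>] (0 : ℝ)) (𝓝 0) := by
    intro M hM
    refine tendsto_of_tendsto_of_tendsto_of_le_of_le' tendsto_const_nhds hs
      (Eventually.of_forall fun _ => zero_le) ?_
    filter_upwards [hC, hev] with ε hCε hε
    have hqε := hq ε hε
    refine (matL1Norm_le_of_entries hqε hq₀ (hM ε)).trans ?_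
    gcongr
    refine add_le_add (eLpNorm_one_sub_le hqε.1 hq₀.1 ?_ ?_)
      (eLpNorm_one_sub_le (integrable_sq_of_memLp_two hqε).1 (integrable_sq_of_memLp_two hq₀).1
        ?_ ?_)
    · refine (eLpNorm_one_le hqε.1).trans ?_
      gcongr
    · exact eLpNorm_one_le hq₀.1
    · refine (eLpNorm_sq_le hqε.1).trans ?_
      gcongr
    · exact eLpNorm_sq_le hq₀.1
  have hsup (ε t : ℝ) (ht : t ∈ Icc a b) : ‖primitive a (fun x => q ε x - q 0 x) t‖ₑ
      + ‖primitive a (fun x => q ε x ^ 2 - q 0 x ^ 2) t‖ₑ ≤ s ε :=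
    add_le_add (enorm_le_supNorm _ ht) (enorm_le_supNorm _ ht)
  refine ⟨main _ fun ε t ht i j => ?_, main _ fun ε t ht i j => ?_, main _ fun ε t ht i j => ?_⟩
  · rw [matPrimitive_matR_eq, matR_eq]
    refine (enorm_entries_le (hsup ε t ht) i j).1.trans ?_
    gcongr
    exact le_self_add
  · rw [matPrimitive_matR_eq, matR_eq]
    refine (enorm_entries_le (hsup ε t ht) i j).2.trans ?_
    gcongr
    exact le_self_add
  · rw [matPrimitive_matR_eq, matR_eq, Matrix.sub_apply, add_mul]
    refine (enorm_sub_le).trans (add_le_add ?_ ?_)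
    · exact (enorm_entries_le (hsup ε t ht) i j).1
    · exact (enorm_entries_le (hsup ε t ht) i j).2

end BoundedPotentials

section Convergence

variable {a b : ℝ} [hab : Fact (a < b)]

theorem ext_J_classL1 {g : ℝ → ℂ} (h : Integrable g (volume.restrict (Icc a b))) {t : ℝ}
    (ht : t ∈ Icc a b) : ext (J (classL1 g : L1 a b)) t = primitive a g t := by
  rw [ext_of_mem _ ht, J_apply, primitive]
  refine intervalIntegral.integral_congr_ae ?_
  filter_upwards [(ae_restrict_iff' measurableSet_Icc).1 (coeFn_classL1 h)] with s hs hs'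
  rw [uIoc_of_le ht.1] at hs'
  exact hs ⟨hs'.1.le, hs'.2.trans ht.2⟩

theorem enorm_J_classL1_le {g : ℝ → ℂ} (h : Integrable g (volume.restrict (Icc a b))) :
    ‖J (classL1 g : L1 a b)‖ₑ ≤ supNorm a b (primitive a g) := by
  by_cases htop : supNorm a b (primitive a g) = ∞
  · rw [htop]; exact le_top
  rw [← ENNReal.ofReal_toReal htop, ← ofReal_norm]
  refine ENNReal.ofReal_le_ofReal ((ContinuousMap.norm_le _ ENNReal.toReal_nonneg).2 fun t => ?_)
  rw [← ext_of_mem _ t.2, ext_J_classL1 h t.2, ← toReal_enorm]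
  exact ENNReal.toReal_mono htop (enorm_le_supNorm _ t.2)

theorem param_self (q₀ : ℝ → ℂ) (α β : Matrix (Fin 2) (Fin 2) ℂ) :
    param (a := a) (b := b) q₀ q₀ α β = (0, 0, 0, α, β) := by
  simp [param, classL1_zero]

theorem tendsto_param {ε₀ : ℝ} (hε₀ : 0 < ε₀) {q : ℝ → ℝ → ℂ}
    {α β : ℝ → Matrix (Fin 2) (Fin 2) ℂ}
    (hq : ∀ ε ∈ Icc (0 : ℝ) ε₀, MemLp (q ε) 2 (volume.restrict (Icc a b)))
    (h2 : Tendsto (fun ε => supNorm a b (primitive a fun x => q ε x - q 0 x)) (𝓝[>] (0 : ℝ)) (𝓝 0))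
    (h3 : Tendsto (fun ε => supNorm a b (primitive a fun x => q ε x ^ 2 - q 0 x ^ 2))
      (𝓝[>] (0 : ℝ)) (𝓝 0))
    (hα : Tendsto α (𝓝[>] (0 : ℝ)) (𝓝 (α 0))) (hβ : Tendsto β (𝓝[>] (0 : ℝ)) (𝓝 (β 0)))
    (hc : CondI a b q ∨ CondII a b q ∨ CondIII a b q) :
    Tendsto (fun ε => param (a := a) (b := b) (q ε) (q 0) (α ε) (β ε)) (𝓝[>] (0 : ℝ))
      (𝓝 (param (q 0) (q 0) (α 0) (β 0))) := by
  have hq₀ := hq 0 ⟨le_rfl, hε₀.le⟩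
  have hev : ∀ᶠ ε in 𝓝[>] (0 : ℝ), ε ∈ Icc 0 ε₀ :=
    mem_of_superset (Ioc_mem_nhdsGT hε₀) Ioc_subset_Icc_self
  rw [param_self]
  refine Tendsto.prodMk_nhds ?_ (Tendsto.prodMk_nhds ?_
    (Tendsto.prodMk_nhds ?_ (hα.prodMk_nhds hβ)))
  · rw [tendsto_zero_iff_enorm_tendsto_zero]
    refine tendsto_of_tendsto_of_tendsto_of_le_of_le' tendsto_const_nhds h2
      (Eventually.of_forall fun _ => zero_le) ?_
    filter_upwards [hev] with ε hε
    exact enorm_J_classL1_le (integrable_sub_of_memLp_two (hq ε hε) hq₀)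
  · rw [tendsto_zero_iff_enorm_tendsto_zero]
    refine tendsto_of_tendsto_of_tendsto_of_le_of_le' tendsto_const_nhds h3
      (Eventually.of_forall fun _ => zero_le) ?_
    filter_upwards [hev] with ε hε
    exact enorm_J_classL1_le (integrable_sq_sub_of_memLp_two (hq ε hε) hq₀)
  · rw [tendsto_zero_iff_enorm_tendsto_zero]
    refine (tendsto_eLpNorm_commutator hc).congr' ?_
    filter_upwards [hev] with ε hε
    rw [Lp.enorm_def]
    refine eLpNorm_congr_ae ?_
    filter_upwards [ae_param (hq ε hε) hq₀ (α ε) (β ε), ae_mem_Ioo] with t ht hm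
    have hm' := Ioo_subset_Icc_self hm
    have h1 := ext_J_classL1 (integrable_sub_of_memLp_two (hq ε hε) hq₀) hm'
    have h2 := ext_J_classL1 (integrable_sq_sub_of_memLp_two (hq ε hε) hq₀) hm'
    rw [← h1, ← h2]
    exact ht.symm

theorem normResolventConverges {ε₀ : ℝ} (hε₀ : 0 < ε₀) {q : ℝ → ℝ → ℂ}
    {α β : ℝ → Matrix (Fin 2) (Fin 2) ℂ}
    (hq : ∀ ε ∈ Icc (0 : ℝ) ε₀, MemLp (q ε) 2 (volume.restrict (Icc a b)))
    (h2 : Tendsto (fun ε => supNorm a b (primitive a fun x => q ε x - q 0 x)) (𝓝[>] (0 : ℝ)) (𝓝 0))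
    (h3 : Tendsto (fun ε => supNorm a b (primitive a fun x => q ε x ^ 2 - q 0 x ^ 2))
      (𝓝[>] (0 : ℝ)) (𝓝 0))
    (hρ : (resolventSet (slOperator a b (q 0) (α 0) (β 0))).Nonempty)
    (hα : Tendsto α (𝓝[>] (0 : ℝ)) (𝓝 (α 0))) (hβ : Tendsto β (𝓝[>] (0 : ℝ)) (𝓝 (β 0)))
    (hc : CondI a b q ∨ CondII a b q ∨ CondIII a b q) :
    NormResolventConverges (fun ε => slOperator a b (q ε) (α ε) (β ε)) := by
  obtain ⟨z, hz⟩ := hρ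
  have hq₀ := hq 0 ⟨le_rfl, hε₀.le⟩
  have hev : ∀ᶠ ε in 𝓝[>] (0 : ℝ), ε ∈ Icc 0 ε₀ :=
    mem_of_superset (Ioc_mem_nhdsGT hε₀) Ioc_subset_Icc_self
  have hlim := tendsto_param hε₀ hq h2 h3 hα hβ hc
  set Q : L1 a b := classL1 (q 0)
  set s : L1 a b := classL1 fun t => q 0 t ^ 2 + z
  have hU : IsUnit (bvpOperator Q s (param (q 0) (q 0) (α 0) (β 0))) :=
    isUnit_bvpOperator_of_mem_resolventSet hq₀ hq₀ (α 0) (β 0) hz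
  have hUε : ∀ᶠ ε in 𝓝[>] (0 : ℝ),
      IsUnit (bvpOperator Q s (param (q ε) (q 0) (α ε) (β ε))) := by
    have hopen := Units.isOpen (R := CI a b × CI a b →L[ℂ] CI a b × CI a b)
    exact (((continuous_bvpOperator Q s).tendsto _).comp hlim).eventually (hopen.mem_nhds hU)
  have hres : ∀ ε ∈ Icc 0 ε₀, IsUnit (bvpOperator Q s (param (q ε) (q 0) (α ε) (β ε))) →
      z ∈ resolventSet (slOperator a b (q ε) (α ε) (β ε)) ∧
        resolvent (slOperator a b (q ε) (α ε) (β ε)) z =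
          solutionOperator Q s (param (q ε) (q 0) (α ε) (β ε)) := by
    intro ε hε hu
    have hS := isResolventAt_solutionOperator (hq ε hε) hq₀ (α ε) (β ε) z hu
    have hm : z ∈ resolventSet (slOperator a b (q ε) (α ε) (β ε)) := ⟨_, hS⟩
    exact ⟨hm, (resolvent_spec hm).unique hS⟩
  refine ⟨z, hz, ?_, ?_⟩
  · filter_upwards [hev, hUε] with ε hε hu
    exact (hres ε hε hu).1
  · have hT := ((continuousAt_solutionOperator Q s _ hU).tendsto).comp hlim
    rw [tendsto_iff_norm_sub_tendsto_zero] at hT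
    refine hT.congr' ?_
    filter_upwards [hev, hUε] with ε hε hu
    rw [(hres ε hε hu).2, (hres 0 ⟨le_rfl, hε₀.le⟩ hU).2]
    rfl

end Convergence

end SturmLiouville

end

theorem theorem4 (a b ε₀ : ℝ) (hab : a < b) (hε₀ : 0 < ε₀)
    (q : ℝ → ℝ → ℂ) (α β : ℝ → Matrix (Fin 2) (Fin 2) ℂ)
    (hq : ∀ ε ∈ Icc (0 : ℝ) ε₀, MemLp (q ε) 2 (volume.restrict (Icc a b)))
    (h2 : Tendsto (fun ε => SturmLiouville.supNorm a b
        (SturmLiouville.primitive a fun x => q ε x - q 0 x)) (𝓝[>] (0 : ℝ)) (𝓝 0))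
    (h3 : Tendsto (fun ε => SturmLiouville.supNorm a b
        (SturmLiouville.primitive a fun x => q ε x ^ 2 - q 0 x ^ 2)) (𝓝[>] (0 : ℝ)) (𝓝 0)) :
    ((SturmLiouville.resolventSet
          (SturmLiouville.slOperator a b (q 0) (α 0) (β 0))).Nonempty →
      Tendsto α (𝓝[>] (0 : ℝ)) (𝓝 (α 0)) →
      Tendsto β (𝓝[>] (0 : ℝ)) (𝓝 (β 0)) →
      (SturmLiouville.CondI a b q ∨ SturmLiouville.CondII a b q ∨
        SturmLiouville.CondIII a b q) →
      SturmLiouville.NormResolventConverges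
        (fun ε => SturmLiouville.slOperator a b (q ε) (α ε) (β ε))) ∧
    (SturmLiouville.BoundedL2 a b q →
      SturmLiouville.CondI a b q ∧ SturmLiouville.CondII a b q ∧
        SturmLiouville.CondIII a b q) := by
  have : Fact (a < b) := ⟨hab⟩
  exact ⟨fun hρ hα hβ hc => SturmLiouville.normResolventConverges hε₀ hq h2 h3 hρ hα hβ hc,
    SturmLiouville.conditions_of_boundedL2 hε₀ hq h2 h3⟩
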